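/- **Theorem.** A unitary $U$ on $\mathbb C^2\otimes\mathbb C^2\otimes\mathbb C^2$ is called *genuine* if it is not a tensor product of two unitaries across any bipartition of the three qubits. The *Schmidt rank* of an operator is the least $r$ such that it is a sum of $r$ product operators $A_{j,1}\otimes A_{j,2}\otimes A_{j,3}$, and a *Schmidt decomposition* is such a sum with the least number of terms. Two operators $X,Y$ are *locally equivalent* if $Y=(V_1\otimes V_2\otimes V_3)X(W_1\otimes W_2\otimes W_3)$ with unitary $V_i,W_i$. For a genuine three-qubit unitary $U$ of Schmidt rank two the *singular number* $k$ is the number of singular matrices among the six local operators of its Schmidt decomposition $A_1\otimes A_2\otimes A_3+B_1\otimes B_2\otimes B_3$ (which is unique up to the order of the two terms and rescaling of the factors). Every genuine three-qubit unitary gate $U$ of Schmidt rank two has singular number $k\in\{0,1,2,3\}$, and, up to a permutation of the three qubits and local equivalence, its Schmidt decomposition is of the following form. (i) If $k=3$: $\;I_2\otimes I_2\otimes I_2+(e^{i\varphi}-1)\,|0,0,0\rangle\langle 0,0,0|$ with $\varphi\in(0,2\pi)$. (ii) If $k=2$: either $\;I_2\otimes I_2\otimes I_2+|1\rangle\langle1|\otimes|1\rangle\langle1|\otimes\operatorname{diag}(e^{i\theta}-1,e^{i\phi}-1)$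 with $\theta,\phi\in(0,2\pi)$, or $\;|0\rangle\langle0|\otimes I_2\otimes I_2+|1\rangle\langle1|\otimes\operatorname{diag}(1,e^{i\gamma})\otimes\operatorname{diag}(1,e^{i\delta})$ with $\gamma,\delta\in[0,2\pi)$. (iii) If $k=1$: for some real $c>0$, $c\ne1$, either $$|0\rangle\langle0|\otimes\operatorname{diag}(e^{i\alpha}-c,e^{-i\alpha}-c)\otimes\operatorname{diag}\Big(1,\tfrac{c^2-1}{1+c^2-2c\cos\alpha}\Big)+\operatorname{diag}(c,1)\otimes I_2\otimes I_2$$ with $\alpha\in(0,\pi)\cup(\pi,2\pi)$ and $c\cos\alpha\neq1$, or $$|0\rangle\langle0|\otimes\operatorname{diag}(e^{i\alpha}-c,-e^{i(\theta-\alpha)}-c)\otimes\operatorname{diag}\Big(1,\tfrac{e^{i\gamma}-c}{e^{i\alpha}-c}\Big)+\operatorname{diag}(c,1)\otimes I_2\otimes I_2$$ with $\alpha,\gamma\in[0,2\pi)$, $c\cos\frac{\alpha+\gamma}2-\cos\frac{\alpha-\gamma}2\neq0$, $\theta=2\arctan\Big(\frac{c\sin\frac{\alpha+\gamma}2-\sin\frac{\alpha-\gamma}2}{c\cos\frac{\alpha+\gamma}2-\cos\frac{\alpha-\gamma}2}\Big)$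 and $\alpha\notin\{\gamma,\frac{\pi+\theta}2,\frac{3\pi+\theta}2\}$. (iv) If $k=0$: $$\operatorname{diag}(a,b)\otimes\operatorname{diag}(1,c)\otimes\operatorname{diag}(1,d)+\operatorname{diag}(1-a,1-b)\otimes\operatorname{diag}\Big(1,\tfrac{1-bc}{1-b}\Big)\otimes\operatorname{diag}\Big(1,\tfrac{1-bd}{1-b}\Big),$$ where $a,b,c,d\in\mathbb C\setminus\{0,1\}$, $a\neq b$, satisfy $$\begin{aligned}|(1-a)(1-d)+d(1-b)|&=|1-b|,\\ |(1-a)(1-c)+c(1-b)|&=|1-b|,\\ |(1-a)(1-bc)(1-bd)+acd(1-b)^2|&=|1-b|^2,\\ |(1-bc)(1-bd)+bcd(1-b)|&=|1-b|.\end{aligned}$$ -/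

import Mathlib

open scoped BigOperators

/-- Operators on `n` subsystems of local dimension `d`, i.e. on `(ℂ^d)^{⊗ n}`, as matrices in the
computational basis; a basis vector `|x 0, …, x (n-1)⟩` is a function `x : Fin n → Fin d`. -/
abbrev MultiOp (n d : ℕ) : Type := Matrix (Fin n → Fin d) (Fin n → Fin d) ℂ

/-- Operators on a single subsystem of dimension `d`. -/
abbrev LocalOp (d : ℕ) : Type := Matrix (Fin d) (Fin d) ℂ

namespace MultiOp

variable {n d : ℕ}

/-- The product operator `A 0 ⊗ A 1 ⊗ ⋯ ⊗ A (n-1)`. -/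
def tensor (A : Fin n → LocalOp d) : MultiOp n d :=
  Matrix.of fun x y => ∏ i, A i (x i) (y i)

/-- `U = V ⊗ W` across the bipartition `S | Sᶜ`, with `V` acting on the subsystems in `S` and `W` on
the remaining ones, both unitary. -/
def IsProductAcross (S : Finset (Fin n)) (U : MultiOp n d) : Prop :=
  ∃ V ∈ Matrix.unitaryGroup ({i // i ∈ S} → Fin d) ℂ,
    ∃ W ∈ Matrix.unitaryGroup ({i // i ∉ S} → Fin d) ℂ,
      ∀ x y : Fin n → Fin d,
        U x y = V (fun i => x i) (fun i => y i) * W (fun i => x i) (fun i => y i)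

/-- A genuine multipartite unitary gate: a unitary that is not a tensor product of two unitaries
across any bipartition of the subsystems into two nonempty parts. -/
def IsGenuineUnitary (U : MultiOp n d) : Prop :=
  U ∈ Matrix.unitaryGroup (Fin n → Fin d) ℂ ∧
    ∀ S : Finset (Fin n), S.Nonempty → S ≠ Finset.univ → ¬ IsProductAcross S U

/-- `U` is the sum of the `r` product operators `T j 0 ⊗ ⋯ ⊗ T j (n-1)`. -/
def IsSumOfProducts {r : ℕ} (U : MultiOp n d) (T : Fin r → Fin n → LocalOp d) : Prop :=
  U = ∑ j, tensor (T j)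

/-- The (operator) Schmidt rank: the least number of product operators with sum `U`. -/
noncomputable def schmidtRank (U : MultiOp n d) : ℕ :=
  sInf {r : ℕ | ∃ T : Fin r → Fin n → LocalOp d, IsSumOfProducts U T}

/-- A Schmidt decomposition: an expression as a sum of product operators with the least possible
number of terms (no orthogonality is required). -/
def IsSchmidtDecomposition {r : ℕ} (U : MultiOp n d) (T : Fin r → Fin n → LocalOp d) : Prop :=
  IsSumOfProducts U T ∧ r = schmidtRank U

/-- The number of singular matrices among all the local operators `T j i`. -/
noncomputable def numSingular {r : ℕ} (T : Fin r → Fin n → LocalOp d) : ℕ :=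
  Nat.card {p : Fin r × Fin n // (T p.1 p.2).det = 0}

/-- `U` has singular number `k`: `U` has a Schmidt decomposition in which exactly `k` of the local
operators are singular. (For a genuine gate of Schmidt rank two on at least three subsystems the
product operators in the Schmidt decomposition are unique, so `k` is determined by `U`.) -/
def HasSingularNumber (U : MultiOp n d) (k : ℕ) : Prop :=
  ∃ (r : ℕ) (T : Fin r → Fin n → LocalOp d), IsSchmidtDecomposition U T ∧ numSingular T = k

/-- The set `𝒞(n, d, k)` of genuine `n`-partite unitary gates of Schmidt rank two with local
dimension `d` and singular number `k`. -/
def gateClass (n d k : ℕ) : Set (MultiOp n d) :=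
  {U | IsGenuineUnitary U ∧ schmidtRank U = 2 ∧ HasSingularNumber U k}

/-- Local unitary equivalence: `Y = (⊗ V i) X (⊗ W i)` with all `V i`, `W i` unitary. -/
def LUEquivalent (X Y : MultiOp n d) : Prop :=
  ∃ V W : Fin n → LocalOp d,
    (∀ i, V i ∈ Matrix.unitaryGroup (Fin d) ℂ) ∧ (∀ i, W i ∈ Matrix.unitaryGroup (Fin d) ℂ) ∧
      Y = tensor V * X * tensor W

/-- The operator obtained from `U` by permuting the subsystems. -/
def permuteSystems (σ : Equiv.Perm (Fin n)) (U : MultiOp n d) : MultiOp n d :=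
  U.submatrix (fun x => x ∘ σ) (fun x => x ∘ σ)

/-- Up to a permutation of the subsystems and local unitary equivalence, the Schmidt decomposition
of `U` is `A 0 ⊗ ⋯ ⊗ A (n-1) + B 0 ⊗ ⋯ ⊗ B (n-1)`. -/
def HasSchmidtForm (U : MultiOp n d) (A B : Fin n → LocalOp d) : Prop :=
  ∃ (σ : Equiv.Perm (Fin n)) (U' : MultiOp n d),
    LUEquivalent (permuteSystems σ U) U' ∧ IsSchmidtDecomposition U' ![A, B]

end MultiOp

/-- The single-qubit diagonal operator `diag(a, b)`; thus `|0⟩⟨0| = qdiag 1 0` and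
`|1⟩⟨1| = qdiag 0 1`. -/
def qdiag (a b : ℂ) : LocalOp 2 := Matrix.diagonal ![a, b]

/-- The phase `e^{i t}`. -/
noncomputable def phase (t : ℝ) : ℂ := Complex.exp (t * Complex.I)

namespace MultiOp

open Matrix

section TensorAlgebra

variable {n d : ℕ}

lemma tensor_apply (A : Fin n → LocalOp d) (x y : Fin n → Fin d) :
    tensor A x y = ∏ i, A i (x i) (y i) := rfl

lemma tensor_mul (A B : Fin n → LocalOp d) :
    tensor A * tensor B = tensor (fun i => A i * B i) := by
  ext x y
  simp only [tensor_apply, Matrix.mul_apply, Finset.prod_univ_sum, Fintype.piFinset_univ,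
    Finset.prod_mul_distrib]

lemma tensor_diagonal (a : Fin n → Fin d → ℂ) :
    tensor (fun i => diagonal (a i)) = diagonal (fun x => ∏ i, a i (x i)) := by
  ext x y
  by_cases h : x = y
  · subst h; simp [tensor_apply]
  · obtain ⟨i, hi⟩ := Function.ne_iff.1 h
    rw [diagonal_apply_ne _ h, tensor_apply]
    exact Finset.prod_eq_zero (Finset.mem_univ i) (diagonal_apply_ne _ hi)

lemma tensor_one : tensor (fun _ : Fin n => (1 : LocalOp d)) = 1 := by
  have := tensor_diagonal (n := n) (d := d) (fun _ _ => 1)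
  simpa [← diagonal_one] using this

lemma tensor_conjTranspose (A : Fin n → LocalOp d) : (tensor A)ᴴ = tensor (fun i => (A i)ᴴ) := by
  ext x y
  simp [tensor_apply, conjTranspose_apply]

lemma tensor_mem_unitaryGroup {V : Fin n → LocalOp d} (hV : ∀ i, V i ∈ unitaryGroup (Fin d) ℂ) :
    tensor V ∈ unitaryGroup (Fin n → Fin d) ℂ := by
  have h i := mem_unitaryGroup_iff.1 (hV i)
  simp only [star_eq_conjTranspose] at h
  rw [mem_unitaryGroup_iff, star_eq_conjTranspose, tensor_conjTranspose, tensor_mul]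
  simp only [h, tensor_one]

lemma permuteSystems_tensor (σ : Equiv.Perm (Fin n)) (A : Fin n → LocalOp d) :
    permuteSystems σ (tensor A) = tensor (fun i => A (σ.symm i)) := by
  ext x y
  simp only [permuteSystems, submatrix_apply, tensor_apply, Function.comp]
  exact Fintype.prod_equiv σ _ _ (by simp)

lemma permuteSystems_mul (σ : Equiv.Perm (Fin n)) (X Y : MultiOp n d) :
    permuteSystems σ (X * Y) = permuteSystems σ X * permuteSystems σ Y :=
  (submatrix_mul_equiv X Y (fun x : Fin n → Fin d => x ∘ σ)
    (Equiv.arrowCongr σ.symm (Equiv.refl _)) (fun x => x ∘ σ)).symm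

lemma permuteSystems_permuteSystems (σ τ : Equiv.Perm (Fin n)) (X : MultiOp n d) :
    permuteSystems τ (permuteSystems σ X) = permuteSystems (τ * σ) X := by
  ext x y
  simp [permuteSystems, Function.comp_assoc]

lemma permuteSystems_one (X : MultiOp n d) : permuteSystems 1 X = X := by
  ext x y
  simp [permuteSystems]

/-- Equality up to a permutation of the subsystems and local unitary equivalence. -/
def PermLUEquivalent (X Y : MultiOp n d) : Prop :=
  ∃ σ : Equiv.Perm (Fin n), LUEquivalent (permuteSystems σ X) Y

lemma LUEquivalent.trans {X Y Z : MultiOp n d} (h : LUEquivalent X Y) (h' : LUEquivalent Y Z) :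
    LUEquivalent X Z := by
  obtain ⟨V, W, hV, hW, rfl⟩ := h
  obtain ⟨V', W', hV', hW', rfl⟩ := h'
  refine ⟨fun i => V' i * V i, fun i => W i * W' i, fun i => mul_mem (hV' i) (hV i),
    fun i => mul_mem (hW i) (hW' i), ?_⟩
  simp only [← tensor_mul, Matrix.mul_assoc]

lemma LUEquivalent.symm {X Y : MultiOp n d} (h : LUEquivalent X Y) : LUEquivalent Y X := by
  obtain ⟨V, W, hV, hW, rfl⟩ := h
  refine ⟨fun i => (V i)ᴴ, fun i => (W i)ᴴ, fun i => Unitary.star_mem (hV i),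
    fun i => Unitary.star_mem (hW i), ?_⟩
  have h1 : tensor (fun i => (V i)ᴴ) * tensor V = 1 := by
    rw [← tensor_conjTranspose]
    exact mem_unitaryGroup_iff'.1 (tensor_mem_unitaryGroup hV)
  have h2 : tensor W * tensor (fun i => (W i)ᴴ) = 1 := by
    rw [← tensor_conjTranspose]
    exact mem_unitaryGroup_iff.1 (tensor_mem_unitaryGroup hW)
  calc X = (tensor (fun i => (V i)ᴴ) * tensor V) * X * (tensor W * tensor (fun i => (W i)ᴴ)) := by
        rw [h1, h2, Matrix.one_mul, Matrix.mul_one]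
    _ = _ := by simp only [Matrix.mul_assoc]

lemma LUEquivalent.permuteSystems {X Y : MultiOp n d} (h : LUEquivalent X Y)
    (σ : Equiv.Perm (Fin n)) : LUEquivalent (permuteSystems σ X) (permuteSystems σ Y) := by
  obtain ⟨V, W, hV, hW, rfl⟩ := h
  exact ⟨_, _, fun i => hV (σ.symm i), fun i => hW (σ.symm i), by
    rw [permuteSystems_mul, permuteSystems_mul, permuteSystems_tensor, permuteSystems_tensor]⟩

lemma PermLUEquivalent.trans {X Y Z : MultiOp n d} (h : PermLUEquivalent X Y)
    (h' : PermLUEquivalent Y Z) : PermLUEquivalent X Z := by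
  obtain ⟨σ, h⟩ := h
  obtain ⟨τ, h'⟩ := h'
  refine ⟨τ * σ, ?_⟩
  rw [← permuteSystems_permuteSystems]
  exact (h.permuteSystems τ).trans h'

lemma LUEquivalent.permLUEquivalent {X Y : MultiOp n d} (h : LUEquivalent X Y) :
    PermLUEquivalent X Y := ⟨1, by rwa [permuteSystems_one]⟩

lemma PermLUEquivalent.symm {X Y : MultiOp n d} (h : PermLUEquivalent X Y) :
    PermLUEquivalent Y X := by
  obtain ⟨σ, h⟩ := h
  refine ⟨σ⁻¹, ?_⟩
  have := (h.permuteSystems σ⁻¹).symm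
  rwa [permuteSystems_permuteSystems, inv_mul_cancel, permuteSystems_one] at this

lemma PermLUEquivalent.exists_isSumOfProducts {X Y : MultiOp n d} (h : PermLUEquivalent X Y)
    {r : ℕ} {T : Fin r → Fin n → LocalOp d} (hT : IsSumOfProducts X T) :
    ∃ T' : Fin r → Fin n → LocalOp d, IsSumOfProducts Y T' := by
  obtain ⟨σ, V, W, -, -, rfl⟩ := h
  refine ⟨fun j i => V i * T j (σ.symm i) * W i, ?_⟩
  have hs : permuteSystems σ (∑ j, tensor (T j)) = ∑ j, permuteSystems σ (tensor (T j)) := by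
    ext x y
    simp [permuteSystems, Matrix.sum_apply]
  unfold IsSumOfProducts at hT ⊢
  rw [hT, hs, Matrix.mul_sum, Matrix.sum_mul]
  simp only [← tensor_mul, permuteSystems_tensor]

lemma PermLUEquivalent.schmidtRank_eq {X Y : MultiOp n d} (h : PermLUEquivalent X Y) :
    schmidtRank X = schmidtRank Y := by
  unfold schmidtRank
  congr 1
  ext r
  exact ⟨fun ⟨_, hT⟩ => h.exists_isSumOfProducts hT,
    fun ⟨_, hT⟩ => h.symm.exists_isSumOfProducts hT⟩

lemma PermLUEquivalent.hasSchmidtForm {U : MultiOp n d} {A B : Fin n → LocalOp d}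
    (h : PermLUEquivalent U (tensor A + tensor B)) (hr : schmidtRank U = 2) :
    HasSchmidtForm U A B := by
  have hr' := h.schmidtRank_eq
  obtain ⟨σ, h⟩ := h
  refine ⟨σ, _, h, ?_, by rw [← hr', hr]⟩
  simp [IsSumOfProducts]

lemma diagonal_mem_unitaryGroup {m : Type*} [Fintype m] [DecidableEq m] {u : m → ℂ}
    (hu : ∀ x, ‖u x‖ = 1) : diagonal u ∈ unitaryGroup m ℂ := by
  rw [mem_unitaryGroup_iff, star_eq_conjTranspose, diagonal_conjTranspose, diagonal_mul_diagonal,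
    ← diagonal_one]
  congr 1
  ext x
  have : u x * star (u x) = ((‖u x‖ ^ 2 : ℝ) : ℂ) := by
    rw [Complex.star_def, Complex.mul_conj, Complex.normSq_eq_norm_sq]
  simpa [hu x] using this

lemma norm_eq_one_of_diagonal_mem_unitaryGroup {m : Type*} [Fintype m] [DecidableEq m]
    {u : m → ℂ} (hu : diagonal u ∈ unitaryGroup m ℂ) (x : m) : ‖u x‖ = 1 := by
  rw [mem_unitaryGroup_iff, star_eq_conjTranspose, diagonal_conjTranspose, diagonal_mul_diagonal,
    ← diagonal_one] at hu
  have h := congrFun (diagonal_injective hu) x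
  have : u x * star (u x) = ((‖u x‖ ^ 2 : ℝ) : ℂ) := by
    rw [Complex.star_def, Complex.mul_conj, Complex.normSq_eq_norm_sq]
  simp only [Pi.star_apply, this] at h
  have h1 : ‖u x‖ ^ 2 = 1 := by exact_mod_cast h
  exact (pow_eq_one_iff_of_nonneg (norm_nonneg _) two_ne_zero).1 h1

/-- Local phases and local relabellings of the basis are local unitaries. -/
lemma LUEquivalent.diagonal_relabel (F : (Fin n → Fin d) → ℂ) (τ : Fin n → Equiv.Perm (Fin d))
    (u : Fin n → Fin d → ℂ) (hu : ∀ i x, ‖u i x‖ = 1) :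
    LUEquivalent (diagonal F)
      (diagonal fun x => (∏ i, u i (x i)) * F (fun i => τ i (x i))) := by
  have hP (σ : Equiv.Perm (Fin d)) :
      (1 : LocalOp d).submatrix σ id ∈ unitaryGroup (Fin d) ℂ := by
    rw [mem_unitaryGroup_iff, star_eq_conjTranspose, conjTranspose_submatrix, conjTranspose_one,
      ← submatrix_mul _ _ _ _ _ Function.bijective_id, Matrix.one_mul, submatrix_one_equiv]
  have hQ (σ : Equiv.Perm (Fin d)) :
      (1 : LocalOp d).submatrix id σ ∈ unitaryGroup (Fin d) ℂ := by
    rw [mem_unitaryGroup_iff', star_eq_conjTranspose, conjTranspose_submatrix, conjTranspose_one,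
      ← submatrix_mul _ _ _ _ _ Function.bijective_id, Matrix.one_mul, submatrix_one_equiv]
  refine ⟨fun i => diagonal (u i) * (1 : LocalOp d).submatrix (τ i) id,
    fun i => (1 : LocalOp d).submatrix id (τ i),
    fun i => mul_mem (diagonal_mem_unitaryGroup (hu i)) (hP _), fun i => hQ _, ?_⟩
  have h1 : tensor (fun i => (1 : LocalOp d).submatrix (τ i) id) =
      (1 : MultiOp n d).submatrix (fun x i => τ i (x i)) id := by
    rw [← tensor_one]; ext x y; rfl
  have h2 : tensor (fun i => (1 : LocalOp d).submatrix id (τ i)) =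
      (1 : MultiOp n d).submatrix id (fun x i => τ i (x i)) := by
    rw [← tensor_one]; ext x y; rfl
  have hτ : Function.Injective (fun (x : Fin n → Fin d) i => τ i (x i)) := by
    intro x y h
    ext i
    exact congrArg _ ((τ i).injective (congrFun h i))
  rw [← tensor_mul, tensor_diagonal, h1, h2]
  ext x y
  rw [Matrix.mul_assoc, Matrix.mul_assoc, diagonal_mul]
  have h3 : ((1 : MultiOp n d).submatrix (fun x i => τ i (x i)) id *
      (diagonal F * (1 : MultiOp n d).submatrix id (fun x i => τ i (x i)))) =
      (diagonal F).submatrix (fun (x : Fin n → Fin d) i => τ i (x i))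
        (fun (x : Fin n → Fin d) i => τ i (x i)) := by
    ext x y
    simp only [Matrix.mul_apply, Matrix.one_apply, diagonal_apply, submatrix_apply, id, ite_mul,
      one_mul, zero_mul, mul_ite, mul_one, mul_zero, Finset.sum_ite_eq',
      Finset.mem_univ, if_true]
    split_ifs with h
    · rw [h]
    · rfl
  rw [h3, submatrix_apply]
  by_cases h : x = y
  · subst h; simp
  · rw [diagonal_apply_ne _ h, diagonal_apply_ne _ (fun h' => h (hτ h')), mul_zero]

end TensorAlgebra

end MultiOp

namespace MultiOp

open Matrix
open scoped Kronecker ComplexOrder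

section Control

lemma exists_unitary_with_first_column {v : Fin 2 → ℂ} (hv : v ≠ 0) :
    ∃ E ∈ unitaryGroup (Fin 2) ℂ, ∃ t : ℂ, ∀ i, E i 0 = t * v i := by
  have hN : 0 < Complex.normSq (v 0) + Complex.normSq (v 1) := by
    by_contra h
    have h0 := Complex.normSq_nonneg (v 0)
    have h1 := Complex.normSq_nonneg (v 1)
    apply hv
    ext i
    fin_cases i
    · exact Complex.normSq_eq_zero.1 (show Complex.normSq (v 0) = 0 by linarith)
    · exact Complex.normSq_eq_zero.1 (show Complex.normSq (v 1) = 0 by linarith)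
  obtain ⟨t, ht⟩ : ∃ t : ℝ, t ^ 2 * (Complex.normSq (v 0) + Complex.normSq (v 1)) = 1 :=
    ⟨(√(Complex.normSq (v 0) + Complex.normSq (v 1)))⁻¹, by
      rw [inv_pow, Real.sq_sqrt hN.le, inv_mul_cancel₀ hN.ne']⟩
  have ht' : (t : ℂ) ^ 2 * (v 0 * star (v 0) + v 1 * star (v 1)) = 1 := by
    simp only [Complex.star_def, Complex.mul_conj]
    exact_mod_cast ht
  simp only [Complex.star_def] at ht'
  refine ⟨!![t * v 0, -(t * star (v 1)); t * v 1, t * star (v 0)], ?_, t, ?_⟩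
  · rw [mem_unitaryGroup_iff', star_eq_conjTranspose]
    ext i j
    fin_cases i <;> fin_cases j <;>
      simp [Matrix.mul_apply, Fin.sum_univ_two] <;> first | ring1 | linear_combination ht'
  · intro i
    fin_cases i <;> simp

/-- Spectral theorem for normal matrices of size two. -/
lemma exists_unitary_diagonalization {N : Matrix (Fin 2) (Fin 2) ℂ} (hN : N * Nᴴ = Nᴴ * N) :
    ∃ E ∈ unitaryGroup (Fin 2) ℂ, ∃ D : Fin 2 → ℂ, N = E * diagonal D * Eᴴ := by
  obtain ⟨μ, hμ⟩ := Module.End.exists_eigenvalue (toLin' N)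
  obtain ⟨v, hv⟩ := hμ.exists_hasEigenvector
  have hv1 : N *ᵥ v = μ • v := by simpa using hv.apply_eq_smul
  obtain ⟨E, hE, t, ht⟩ := exists_unitary_with_first_column hv.2
  have hE1 : Eᴴ * E = 1 := mem_unitaryGroup_iff'.1 hE
  have hE2 : E * Eᴴ = 1 := mem_unitaryGroup_iff.1 hE
  obtain ⟨T, hT⟩ : ∃ T, T = Eᴴ * (N * E) := ⟨_, rfl⟩
  have hNE i : (N * E) i 0 = μ * E i 0 := by
    have := congrFun hv1 i
    simp only [mulVec, dotProduct, Pi.smul_apply, smul_eq_mul] at this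
    simp only [Matrix.mul_apply, ht]
    rw [mul_left_comm μ t, ← this, Finset.mul_sum]
    exact Finset.sum_congr rfl fun _ _ => by ring
  have h10 : T 1 0 = 0 := by
    have : T 1 0 = μ * (Eᴴ * E) 1 0 := by
      rw [hT, Matrix.mul_apply, Matrix.mul_apply, Finset.mul_sum]
      exact Finset.sum_congr rfl fun _ _ => by rw [hNE]; ring
    rw [this, hE1]; simp
  have hTn : T * Tᴴ = Tᴴ * T := by
    have e1 : T * Tᴴ = Eᴴ * (N * (E * Eᴴ) * Nᴴ) * E := by
      simp only [hT, conjTranspose_mul, conjTranspose_conjTranspose, Matrix.mul_assoc]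
    have e2 : Tᴴ * T = Eᴴ * (Nᴴ * (E * Eᴴ) * N) * E := by
      simp only [hT, conjTranspose_mul, conjTranspose_conjTranspose, Matrix.mul_assoc]
    rw [e1, e2, hE2, Matrix.mul_one, Matrix.mul_one, hN]
  have h01 : T 0 1 = 0 := by
    have := congrFun (congrFun hTn 0) 0
    simp only [Matrix.mul_apply, Fin.sum_univ_two, conjTranspose_apply, h10, star_zero] at this
    have h2 : T 0 1 * star (T 0 1) = 0 := by linear_combination this
    simpa using h2
  refine ⟨E, hE, ![T 0 0, T 1 1], ?_⟩
  have hTd : diagonal ![T 0 0, T 1 1] = T := by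
    ext i j
    fin_cases i <;> fin_cases j <;> simp [h01, h10]
  calc N = (E * Eᴴ) * N * (E * Eᴴ) := by rw [hE2]; simp
    _ = _ := by rw [hTd, hT]; simp only [Matrix.mul_assoc]

lemma trace_conjTranspose_mul_self {m : Type*} [Fintype m] (X : Matrix m m ℂ) (hX : X ≠ 0) :
    ∃ t : ℝ, 0 < t ∧ (Xᴴ * X).trace = t := by
  refine ⟨∑ i, ∑ j, Complex.normSq (X j i), ?_, ?_⟩
  · refine lt_of_le_of_ne
      (Finset.sum_nonneg fun i _ => Finset.sum_nonneg fun j _ => Complex.normSq_nonneg _) ?_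
    intro h
    apply hX
    rw [eq_comm, Finset.sum_eq_zero_iff_of_nonneg
      (fun i _ => Finset.sum_nonneg fun j _ => Complex.normSq_nonneg _)] at h
    ext j i
    have := (Finset.sum_eq_zero_iff_of_nonneg (fun j _ => Complex.normSq_nonneg _)).1
      (h i (Finset.mem_univ _)) j (Finset.mem_univ _)
    simpa using this
  · simp only [Matrix.trace, diag_apply, Matrix.mul_apply, conjTranspose_apply, Complex.star_def,
      Complex.normSq_eq_conj_mul_self, Complex.ofReal_sum]

variable {m : Type*} [Fintype m] [DecidableEq m]

lemma sum_conjTranspose_kronecker {A : Fin 2 → Matrix (Fin 2) (Fin 2) ℂ} {P : Fin 2 → Matrix m m ℂ}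
    (hU : ∑ j, A j ⊗ₖ P j ∈ unitaryGroup (Fin 2 × m) ℂ) (p q : m) :
    ∑ j, ∑ k, ((P j)ᴴ * P k) p q • ((A j)ᴴ * A k) = (1 : Matrix m m ℂ) p q • 1 := by
  rw [mem_unitaryGroup_iff', star_eq_conjTranspose, conjTranspose_sum, Finset.sum_mul_sum] at hU
  simp only [conjTranspose_kronecker, ← mul_kronecker_mul] at hU
  ext x y
  have h := congrFun (congrFun hU (x, p)) (y, q)
  simp only [Matrix.sum_apply, kroneckerMap_apply] at h
  simp only [Matrix.sum_apply, Matrix.smul_apply, smul_eq_mul]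
  rw [← one_kronecker_one, kroneckerMap_apply] at h
  rw [mul_comm, ← h]
  exact Finset.sum_congr rfl fun _ _ => Finset.sum_congr rfl fun _ _ => mul_comm _ _

lemma exists_relation_of_unitary [Nonempty m] {A : Fin 2 → Matrix (Fin 2) (Fin 2) ℂ}
    {P : Fin 2 → Matrix m m ℂ} (hU : ∑ j, A j ⊗ₖ P j ∈ unitaryGroup (Fin 2 × m) ℂ)
    (hP : LinearIndependent ℂ P) :
    ∃ M : Matrix (Fin 2) (Fin 2) ℂ, M ≠ 0 ∧ ∑ j, ∑ k, M j k • ((A j)ᴴ * A k) = 0 := by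
  by_contra! hM
  have hM' (M : Matrix (Fin 2) (Fin 2) ℂ) (h : ∑ j, ∑ k, M j k • ((A j)ᴴ * A k) = 0) : M = 0 := by
    by_contra h'
    exact hM M h' h
  have hrel := sum_conjTranspose_kronecker hU
  obtain ⟨p₀⟩ := ‹Nonempty m›
  have hscalar j k : (P j)ᴴ * P k = ((P j)ᴴ * P k) p₀ p₀ • (1 : Matrix m m ℂ) := by
    ext p q
    by_cases hpq : p = q
    · subst hpq
      have h := hM' (Matrix.of fun j k => ((P j)ᴴ * P k) p p - ((P j)ᴴ * P k) p₀ p₀) (by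
        simp only [Matrix.of_apply, sub_smul, Finset.sum_sub_distrib, hrel, one_apply_eq, sub_self])
      have := congrFun (congrFun h j) k
      simpa [sub_eq_zero] using this
    · have h := hM' (Matrix.of fun j k => ((P j)ᴴ * P k) p q) (by
        simp only [Matrix.of_apply, hrel, one_apply_ne hpq, zero_smul])
      have := congrFun (congrFun h j) k
      simpa [one_apply_ne hpq] using this
  have h0 : P 0 ≠ 0 := hP.ne_zero 0
  obtain ⟨c, hc⟩ : ∃ c, c = ((P 0)ᴴ * P 0) p₀ p₀ := ⟨_, rfl⟩
  have hc0 : c ≠ 0 := by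
    intro h
    apply h0
    rw [← conjTranspose_mul_self_eq_zero, hscalar, ← hc, h, zero_smul]
  have h1 : P 0 * (c⁻¹ • (P 0)ᴴ) = 1 := by
    rw [mul_eq_one_comm, smul_mul, hscalar, ← hc, smul_smul, inv_mul_cancel₀ hc0, one_smul]
  have h2 : P 1 = (c⁻¹ * ((P 0)ᴴ * P 1) p₀ p₀) • P 0 := by
    calc P 1 = P 0 * (c⁻¹ • (P 0)ᴴ) * P 1 := by rw [h1, Matrix.one_mul]
      _ = c⁻¹ • (P 0 * ((P 0)ᴴ * P 1)) := by simp [Matrix.mul_assoc]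
      _ = _ := by rw [hscalar, Matrix.mul_smul, Matrix.mul_one, smul_smul]; simp
  have h3 := Fintype.linearIndependent_iff.1 hP ![(c⁻¹ * ((P 0)ᴴ * P 1) p₀ p₀), -1] (by
    simp [Fin.sum_univ_two, ← h2]) 1
  simp at h3

lemma exists_hermitian_relation_of_unitary [Nonempty m] {A : Fin 2 → Matrix (Fin 2) (Fin 2) ℂ}
    {P : Fin 2 → Matrix m m ℂ} (hU : ∑ j, A j ⊗ₖ P j ∈ unitaryGroup (Fin 2 × m) ℂ)
    (hP : LinearIndependent ℂ P) :
    ∃ M : Matrix (Fin 2) (Fin 2) ℂ, M ≠ 0 ∧ Mᴴ = M ∧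
      ∑ j, ∑ k, M j k • ((A j)ᴴ * A k) = 0 := by
  obtain ⟨M, hM, hrel⟩ := exists_relation_of_unitary hU hP
  have hrel' : ∑ j, ∑ k, Mᴴ j k • ((A j)ᴴ * A k) = 0 := by
    have := congrArg conjTranspose hrel
    simp only [conjTranspose_sum, conjTranspose_smul, conjTranspose_mul,
      conjTranspose_conjTranspose, conjTranspose_zero] at this
    rw [Finset.sum_comm] at this
    exact this
  by_cases h : M + Mᴴ = 0
  · refine ⟨Complex.I • M, by simpa using hM, ?_, ?_⟩
    · rw [conjTranspose_smul, ← neg_eq_of_add_eq_zero_right h]; simp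
    · simp only [Matrix.smul_apply, smul_assoc, ← Finset.smul_sum, hrel, smul_zero]
  · refine ⟨_, h, by simp [add_comm], ?_⟩
    simp only [Matrix.add_apply, add_smul, Finset.sum_add_distrib, hrel, hrel', add_zero]

/-- A space of operators on the control side of a unitary of Schmidt rank two is spanned by two
operators with proportional absolute values. -/
lemma exists_proportional_gram [Nonempty m] {A : Fin 2 → Matrix (Fin 2) (Fin 2) ℂ}
    {P : Fin 2 → Matrix m m ℂ} (hU : ∑ j, A j ⊗ₖ P j ∈ unitaryGroup (Fin 2 × m) ℂ)
    (hA : LinearIndependent ℂ A) (hP : LinearIndependent ℂ P) :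
    ∃ (X Y : Matrix (Fin 2) (Fin 2) ℂ) (s : ℝ) (α β : Fin 2 → ℂ), 0 < s ∧
      Yᴴ * Y = (s : ℂ) • (Xᴴ * X) ∧ ∀ j, A j = α j • X + β j • Y := by
  obtain ⟨M, hM, hMh, hrel⟩ := exists_hermitian_relation_of_unitary hU hP
  obtain ⟨E, hE, D, hD⟩ := exists_unitary_diagonalization (N := M) (by rw [hMh])
  have hE2 : E * Eᴴ = 1 := mem_unitaryGroup_iff.1 hE
  have hE1 : Eᴴ * E = 1 := mem_unitaryGroup_iff'.1 hE
  obtain ⟨X, hX⟩ : ∃ X : Fin 2 → Matrix (Fin 2) (Fin 2) ℂ, ∀ l, X l = ∑ k, star (E k l) • A k :=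
    ⟨_, fun _ => rfl⟩
  have hrelX : ∑ l, D l • ((X l)ᴴ * X l) = 0 := by
    rw [← hrel, hD]
    simp only [hX, Fin.sum_univ_two, conjTranspose_add, conjTranspose_smul, star_star,
      Matrix.mul_apply, conjTranspose_apply, diagonal_apply, zero_ne_one, one_ne_zero, if_true,
      if_false, mul_zero, add_zero, zero_add, Matrix.add_mul, Matrix.mul_add,
      Matrix.smul_mul, Matrix.mul_smul, smul_add, smul_smul, add_smul]
    module
  have hAX k : A k = ∑ l, E k l • X l := by
    have h0 := congrFun (congrFun hE2 k) 0
    have h1 := congrFun (congrFun hE2 k) 1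
    simp only [Matrix.mul_apply, Fin.sum_univ_two, conjTranspose_apply] at h0 h1
    simp only [hX, Fin.sum_univ_two, smul_add, smul_smul]
    calc A k = (1 : Matrix (Fin 2) (Fin 2) ℂ) k 0 • A 0
          + (1 : Matrix (Fin 2) (Fin 2) ℂ) k 1 • A 1 := by
            obtain rfl | rfl : k = 0 ∨ k = 1 := by fin_cases k <;> simp
            all_goals simp
      _ = _ := by rw [← h0, ← h1]; module
  have hX0 l : X l ≠ 0 := by
    intro h
    have h1 := Fintype.linearIndependent_iff.1 hA (fun k => star (E k l)) (by rw [← hX, h])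
    have h2 := congrFun (congrFun hE1 l) l
    simp [Matrix.mul_apply, conjTranspose_apply, h1] at h2
  obtain ⟨t₀, ht₀, htr₀⟩ := trace_conjTranspose_mul_self (X 0) (hX0 0)
  obtain ⟨t₁, ht₁, htr₁⟩ := trace_conjTranspose_mul_self (X 1) (hX0 1)
  have htr := congrArg trace hrelX
  rw [Fin.sum_univ_two] at htr hrelX
  simp only [trace_add, trace_smul, htr₀, htr₁, trace_zero, smul_eq_mul] at htr
  have ht₀' : (t₀ : ℂ) ≠ 0 := by exact_mod_cast ht₀.ne'
  have hD0 : D 0 = -(D 1 * (t₁ / t₀ : ℝ)) := by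
    push_cast
    field_simp
    linear_combination htr
  have hD1 : D 1 ≠ 0 := by
    intro h
    apply hM
    have : D = 0 := by
      ext i
      fin_cases i
      · simp [hD0, h]
      · simpa using h
    rw [hD, this]; simp
  refine ⟨X 0, X 1, t₁ / t₀, fun j => E j 0, fun j => E j 1, by positivity, ?_, fun j => by
    rw [hAX j, Fin.sum_univ_two]⟩
  have h : D 1 • ((X 1)ᴴ * X 1 - ((t₁ / t₀ : ℝ) : ℂ) • ((X 0)ᴴ * X 0)) = 0 := by
    rw [← hrelX, hD0]; module
  exact sub_eq_zero.1 ((smul_eq_zero.1 h).resolve_left hD1)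

/-- A unitary of Schmidt rank two is controlled from a qubit: the local operators on that qubit
are simultaneously diagonal up to local unitaries. -/
theorem exists_simultaneous_diagonalization [Nonempty m] {A : Fin 2 → Matrix (Fin 2) (Fin 2) ℂ}
    {P : Fin 2 → Matrix m m ℂ} (hU : ∑ j, A j ⊗ₖ P j ∈ unitaryGroup (Fin 2 × m) ℂ)
    (hA : LinearIndependent ℂ A) (hP : LinearIndependent ℂ P) :
    ∃ V ∈ unitaryGroup (Fin 2) ℂ, ∃ W ∈ unitaryGroup (Fin 2) ℂ, ∃ d : Fin 2 → Fin 2 → ℂ,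
      ∀ j, V * A j * W = diagonal (d j) := by
  obtain ⟨X, Y, s, α, β, hs, hXY, hAXY⟩ := exists_proportional_gram hU hA hP
  have hXdet : X.det ≠ 0 := by
    intro h
    obtain ⟨v, hv, hXv⟩ := exists_mulVec_eq_zero_iff.2 h
    apply hv
    have hYv : Y *ᵥ v = 0 := by
      rw [← conjTranspose_mul_self_mulVec_eq_zero, hXY, smul_mulVec, ← mulVec_mulVec, hXv]
      simp
    have hAv j : A j *ᵥ v = 0 := by
      rw [hAXY, add_mulVec, smul_mulVec, smul_mulVec, hXv, hYv]; simp
    obtain ⟨p⟩ := ‹Nonempty m›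
    have := congrArg (· *ᵥ v) (sum_conjTranspose_kronecker hU p p)
    simp only [Fin.sum_univ_two, add_mulVec, smul_mulVec, ← mulVec_mulVec, hAv, mulVec_zero,
      smul_zero, add_zero, one_apply_eq, one_mulVec, one_smul] at this
    exact this.symm
  have hXu : IsUnit X.det := hXdet.isUnit
  have hs' : ((√s : ℝ) : ℂ) ≠ 0 := by exact_mod_cast (Real.sqrt_pos.2 hs).ne'
  have hss : ((√s : ℝ) : ℂ) * ((√s : ℝ) : ℂ) = s := by exact_mod_cast Real.mul_self_sqrt hs.le
  obtain ⟨W, hW⟩ : ∃ W, W = ((√s : ℝ) : ℂ)⁻¹ • (Y * X⁻¹) := ⟨_, rfl⟩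
  have hYW : Y = ((√s : ℝ) : ℂ) • (W * X) := by
    rw [hW, smul_mul, smul_smul, mul_inv_cancel₀ hs', one_smul, Matrix.mul_assoc,
      nonsing_inv_mul _ hXu, Matrix.mul_one]
  have hWW : Wᴴ * W = 1 := by
    have : Wᴴ * W = (((√s : ℝ) : ℂ)⁻¹ * ((√s : ℝ) : ℂ)⁻¹) • ((X⁻¹)ᴴ * (Yᴴ * Y) * X⁻¹) := by
      rw [hW]
      simp [conjTranspose_smul, smul_smul, Matrix.mul_assoc]
    rw [this, hXY, ← mul_inv, hss, Matrix.mul_smul, Matrix.smul_mul, smul_smul,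
      inv_mul_cancel₀ (by exact_mod_cast hs.ne'), one_smul, ← Matrix.mul_assoc,
      ← conjTranspose_mul, Matrix.mul_assoc, mul_nonsing_inv _ hXu]
    simp
  obtain ⟨E, hE, D, hD⟩ := exists_unitary_diagonalization (N := W)
    (by rw [hWW, mul_eq_one_comm.1 hWW])
  have hE1 : Eᴴ * E = 1 := mem_unitaryGroup_iff'.1 hE
  have hE2 : E * Eᴴ = 1 := mem_unitaryGroup_iff.1 hE
  obtain ⟨Z, hZ⟩ : ∃ Z, Z = Eᴴ * X := ⟨_, rfl⟩
  obtain ⟨d, hd⟩ : ∃ d : Fin 2 → Fin 2 → ℂ, ∀ j x, d j x = α j + β j * (√s : ℝ) * D x :=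
    ⟨_, fun _ _ => rfl⟩
  have hEA j : Eᴴ * A j = diagonal (d j) * Z := by
    have h1 : diagonal (d j) = α j • 1 + (β j * (√s : ℝ)) • diagonal D := by
      ext x y
      by_cases h : x = y
      · subst h; simp [hd]
      · simp [h]
    have h2 : Eᴴ * W = diagonal D * Eᴴ := by
      rw [hD, ← Matrix.mul_assoc, ← Matrix.mul_assoc, hE1, Matrix.one_mul]
    rw [hAXY, hYW, Matrix.mul_add, Matrix.mul_smul, Matrix.mul_smul, Matrix.mul_smul,
      ← Matrix.mul_assoc, h2, h1, Matrix.add_mul, smul_mul, smul_mul, hZ, Matrix.one_mul,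
      smul_smul, Matrix.mul_assoc]
  obtain ⟨Q, hQ⟩ : ∃ Q : Fin 2 → Matrix m m ℂ, ∀ x, Q x = ∑ j, d j x • P j := ⟨_, fun _ => rfl⟩
  have hblock x y : (Z * Zᴴ) x y • (Q x * (Q y)ᴴ) = (1 : Matrix (Fin 2) (Fin 2) ℂ) x y • 1 := by
    have hU' := mul_mem (kronecker_mem_unitary (Unitary.star_mem hE)
      (one_mem (unitaryGroup m ℂ))) hU
    rw [Matrix.mul_sum] at hU'
    simp only [← mul_kronecker_mul, star_eq_conjTranspose, hEA, Matrix.one_mul] at hU'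
    rw [mem_unitaryGroup_iff, star_eq_conjTranspose, conjTranspose_sum, Finset.sum_mul_sum] at hU'
    simp only [conjTranspose_kronecker, ← mul_kronecker_mul, conjTranspose_mul,
      diagonal_conjTranspose] at hU'
    ext p q
    have h := congrFun (congrFun hU' (x, p)) (y, q)
    rw [← one_kronecker_one, kroneckerMap_apply] at h
    rw [Matrix.smul_apply, Matrix.smul_apply, smul_eq_mul, smul_eq_mul, ← h]
    have e j k : diagonal (d j) * Z * (Zᴴ * diagonal (star (d k)))
        = diagonal (d j) * (Z * Zᴴ) * diagonal (star (d k)) := by simp only [Matrix.mul_assoc]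
    simp only [hQ, Matrix.add_apply, kroneckerMap_apply, conjTranspose_add, Matrix.add_mul,
      Matrix.mul_add, conjTranspose_smul, e, Matrix.mul_diagonal, Matrix.diagonal_mul, smul_mul, Matrix.mul_smul,
      Matrix.smul_apply, smul_eq_mul, Fin.sum_univ_two, Pi.star_apply]
    ring
  have hdiagne x : (Z * Zᴴ) x x • (Q x * (Q x)ᴴ) = 1 := by rw [hblock]; simp
  have hoff x y (hxy : x ≠ y) : (Z * Zᴴ) x y = 0 := by
    by_contra h
    have h0 := hblock x y
    rw [one_apply_ne hxy, zero_smul] at h0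
    have h1 := (smul_eq_zero.1 h0).resolve_left h
    have h2 := hdiagne x
    rw [← Matrix.mul_smul, mul_eq_one_comm, ] at h2
    have h3 : (Q y)ᴴ = 0 := by
      calc (Q y)ᴴ = ((Z * Zᴴ) x x • (Q x)ᴴ) * Q x * (Q y)ᴴ := by rw [h2, Matrix.one_mul]
        _ = 0 := by rw [Matrix.mul_assoc, h1, Matrix.mul_zero]
    have h4 := hdiagne y
    rw [h3] at h4
    obtain ⟨p⟩ := ‹Nonempty m›
    simpa using congrFun (congrFun h4 p) p
  have hpos x : ∃ g : ℝ, 0 < g ∧ (Z * Zᴴ) x x = (g : ℂ) * g := by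
    have h1 : (Z * Zᴴ) x x = ((∑ k, Complex.normSq (Z x k) : ℝ) : ℂ) := by
      simp [Matrix.mul_apply, Complex.mul_conj]
    have h2 : (0 : ℝ) < ∑ k, Complex.normSq (Z x k) := by
      refine lt_of_le_of_ne (Finset.sum_nonneg fun k _ => Complex.normSq_nonneg _) fun h => ?_
      have h4 := hdiagne x
      rw [h1, ← h] at h4
      obtain ⟨p⟩ := ‹Nonempty m›
      simpa using congrFun (congrFun h4 p) p
    exact ⟨√(∑ k, Complex.normSq (Z x k)), Real.sqrt_pos.2 h2, by
      rw [h1]; exact_mod_cast (Real.mul_self_sqrt h2.le).symm⟩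
  choose g hg hZg using hpos
  have hg' x : (g x : ℂ) ≠ 0 := by exact_mod_cast (hg x).ne'
  have hZZ : Z * Zᴴ = diagonal fun x => (g x : ℂ) * g x := by
    ext x y
    by_cases h : x = y
    · subst h; rw [hZg]; simp
    · rw [hoff x y h, diagonal_apply_ne _ h]
  refine ⟨Eᴴ, Unitary.star_mem hE, Zᴴ * diagonal fun x => (g x : ℂ)⁻¹, ?_,
    fun j x => d j x * g x, fun j => ?_⟩
  · have hstar : star (fun x => ((g x : ℂ))⁻¹) = fun x => (g x : ℂ)⁻¹ := by
      ext x; simp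
    rw [mem_unitaryGroup_iff', star_eq_conjTranspose, conjTranspose_mul,
      conjTranspose_conjTranspose, diagonal_conjTranspose, hstar, Matrix.mul_assoc,
      ← Matrix.mul_assoc Z, hZZ, diagonal_mul_diagonal, diagonal_mul_diagonal, ← diagonal_one]
    congr 1
    ext x
    have := hg' x
    field_simp
  · rw [hEA, Matrix.mul_assoc, ← Matrix.mul_assoc Z, hZZ, diagonal_mul_diagonal,
      diagonal_mul_diagonal]
    congr 1
    ext x
    have := hg' x
    field_simp

end Control

end MultiOp

namespace MultiOp

open Matrix
open scoped Kronecker ComplexOrder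

section Genuine

lemma submatrix_mem_unitaryGroup {l m : Type*} [Fintype l] [DecidableEq l] [Fintype m]
    [DecidableEq m] {M : Matrix m m ℂ} (hM : M ∈ unitaryGroup m ℂ) (e : l ≃ m) :
    M.submatrix e e ∈ unitaryGroup l ℂ := by
  rw [mem_unitaryGroup_iff, star_eq_conjTranspose] at hM ⊢
  rw [conjTranspose_submatrix, submatrix_mul_equiv, hM, submatrix_one_equiv]

/-- The factors of a unitary Kronecker product can be rescaled to unitaries. -/
lemma exists_rescale_of_kronecker_mem_unitaryGroup {l m : Type*} [Fintype l] [DecidableEq l]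
    [Fintype m] [DecidableEq m] [Nonempty l] [Nonempty m] {X : Matrix l l ℂ} {Y : Matrix m m ℂ}
    (h : X ⊗ₖ Y ∈ unitaryGroup (l × m) ℂ) :
    ∃ t : ℂ, t ≠ 0 ∧ t • X ∈ unitaryGroup l ℂ ∧ t⁻¹ • Y ∈ unitaryGroup m ℂ := by
  rw [mem_unitaryGroup_iff', star_eq_conjTranspose, conjTranspose_kronecker, ← mul_kronecker_mul,
    ← one_kronecker_one] at h
  have hent (i j : l) (p q : m) : (Xᴴ * X) i j * (Yᴴ * Y) p q
      = (1 : Matrix l l ℂ) i j * (1 : Matrix m m ℂ) p q := congrFun (congrFun h (i, p)) (j, q)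
  obtain ⟨i₀⟩ := ‹Nonempty l›
  obtain ⟨p₀⟩ := ‹Nonempty m›
  obtain ⟨g, hg0, hg⟩ : ∃ g : ℝ, 0 ≤ g ∧ (Yᴴ * Y) p₀ p₀ = g := by
    refine ⟨∑ k, Complex.normSq (Y k p₀), Finset.sum_nonneg fun k _ => Complex.normSq_nonneg _, ?_⟩
    simp [Matrix.mul_apply, Complex.normSq_eq_conj_mul_self]
  have h0 := hent i₀ i₀ p₀ p₀
  rw [hg, one_apply_eq, one_apply_eq, mul_one] at h0
  have hg1 : g ≠ 0 := by
    rintro rfl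
    simp at h0
  have hgp : 0 < g := lt_of_le_of_ne hg0 hg1.symm
  have hgC : (g : ℂ) ≠ 0 := by exact_mod_cast hg1
  have hsq : ((√g : ℝ) : ℂ) * ((√g : ℝ) : ℂ) = g := by exact_mod_cast Real.mul_self_sqrt hg0
  have hsq0 : ((√g : ℝ) : ℂ) ≠ 0 := by exact_mod_cast (Real.sqrt_pos.2 hgp).ne'
  refine ⟨(√g : ℝ), hsq0, ?_, ?_⟩
  · rw [mem_unitaryGroup_iff', star_eq_conjTranspose, conjTranspose_smul, smul_mul, Matrix.mul_smul,
      smul_smul, Complex.star_def, Complex.conj_ofReal, hsq]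
    ext i j
    have := hent i j p₀ p₀
    rw [hg, one_apply_eq, mul_one] at this
    rw [Matrix.smul_apply, smul_eq_mul, mul_comm, this]
  · rw [mem_unitaryGroup_iff', star_eq_conjTranspose, conjTranspose_smul, smul_mul, Matrix.mul_smul,
      smul_smul, star_inv₀, Complex.star_def, Complex.conj_ofReal, ← mul_inv, hsq]
    ext p q
    have := hent i₀ i₀ p q
    rw [one_apply_eq, one_mul] at this
    rw [← this, Matrix.smul_apply, smul_eq_mul]
    have h1 : (Xᴴ * X) i₀ i₀ = (g : ℂ)⁻¹ := eq_inv_of_mul_eq_one_left h0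
    rw [h1]

variable {n d : ℕ}

/-- Basis states of `n` subsystems, as pairs of a state of subsystem `i` and a state of the rest. -/
def splitEquiv (i : Fin n) :
    (Fin n → Fin d) ≃ Fin d × ({j // j ∉ ({i} : Finset (Fin n))} → Fin d) where
  toFun x := (x i, fun j => x j)
  invFun p j := if h : j ∈ ({i} : Finset (Fin n)) then p.1 else p.2 ⟨j, h⟩
  left_inv x := by
    ext j
    by_cases h : j = i
    · subst h; simp
    · simp [h]
  right_inv p := by
    ext j
    · simp
    · have := j.2
      simp [this]

/-- A state of the single subsystem `i`. -/
def singletonEquiv (i : Fin n) : ({j // j ∈ ({i} : Finset (Fin n))} → Fin d) ≃ Fin d where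
  toFun x := x ⟨i, Finset.mem_singleton_self i⟩
  invFun a _ := a
  left_inv x := by
    funext ⟨j, hj⟩
    obtain rfl := Finset.mem_singleton.1 hj
    rfl
  right_inv _ := rfl

lemma IsGenuineUnitary.submatrix_splitEquiv_ne_kronecker {U : MultiOp n d}
    (hU : IsGenuineUnitary U) (hn : 2 ≤ n) [NeZero d] (i : Fin n) (X : LocalOp d)
    (Y : Matrix ({j // j ∉ ({i} : Finset (Fin n))} → Fin d)
      ({j // j ∉ ({i} : Finset (Fin n))} → Fin d) ℂ) :
    U.submatrix (splitEquiv i).symm (splitEquiv i).symm ≠ X ⊗ₖ Y := by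
  intro h
  have hXY := submatrix_mem_unitaryGroup hU.1 (splitEquiv i).symm
  rw [h] at hXY
  obtain ⟨t, ht, hX, hY⟩ := exists_rescale_of_kronecker_mem_unitaryGroup hXY
  refine hU.2 {i} (Finset.singleton_nonempty i) ?_ ⟨_, submatrix_mem_unitaryGroup hX
    (singletonEquiv i), _, hY, fun x y => ?_⟩
  · intro h'
    have := congrArg Finset.card h'
    simp at this
    omega
  · have := congrFun (congrFun h (splitEquiv i x)) (splitEquiv i y)
    rw [submatrix_apply, Equiv.symm_apply_apply, Equiv.symm_apply_apply, kroneckerMap_apply] at this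
    rw [this]
    simp only [splitEquiv, singletonEquiv, Equiv.coe_fn_mk, submatrix_apply, Matrix.smul_apply,
      smul_eq_mul]
    field_simp

/-- The product operator on all the subsystems but `i`. -/
def tensorErase (i : Fin n) (A : Fin n → LocalOp d) :
    Matrix ({j // j ∉ ({i} : Finset (Fin n))} → Fin d)
      ({j // j ∉ ({i} : Finset (Fin n))} → Fin d) ℂ :=
  Matrix.of fun x y => ∏ j : {j // j ∉ ({i} : Finset (Fin n))}, A j (x j) (y j)

lemma submatrix_tensor_splitEquiv (i : Fin n) (A : Fin n → LocalOp d) :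
    (tensor A).submatrix (splitEquiv i).symm (splitEquiv i).symm = A i ⊗ₖ tensorErase i A := by
  ext x y
  obtain ⟨x, rfl⟩ := (splitEquiv i).surjective x
  obtain ⟨y, rfl⟩ := (splitEquiv i).surjective y
  have hprod (f : Fin n → ℂ) :
      ∏ j, f j = f i * ∏ j : {j // j ∉ ({i} : Finset (Fin n))}, f j := by
    rw [← Fintype.prod_subtype_mul_prod_subtype (fun j => j ∈ ({i} : Finset (Fin n))) f]
    congr 1
    convert (Finset.prod_coe_sort ({i} : Finset (Fin n)) f).trans (Finset.prod_singleton f i)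
  rw [submatrix_apply, Equiv.symm_apply_apply, Equiv.symm_apply_apply, tensor_apply, hprod]
  rfl

lemma linearIndependent_pair_of_ne_kronecker {l m : Type*} {A : Fin 2 → Matrix l l ℂ}
    {P : Fin 2 → Matrix m m ℂ} (h : ∀ X Y, ∑ j, A j ⊗ₖ P j ≠ X ⊗ₖ Y) :
    LinearIndependent ℂ A ∧ LinearIndependent ℂ P := by
  simp only [Fin.sum_univ_two] at h
  constructor
  · rw [linearIndependent_fin2]
    refine ⟨fun h1 => h (A 0) (P 0) ?_, fun a ha => h (A 1) (a • P 0 + P 1) ?_⟩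
    · rw [h1, zero_kronecker, add_zero]
    · rw [← ha, smul_kronecker, kronecker_add, kronecker_smul]
  · rw [linearIndependent_fin2]
    refine ⟨fun h1 => h (A 0) (P 0) ?_, fun a ha => h (a • A 0 + A 1) (P 1) ?_⟩
    · rw [h1, kronecker_zero, add_zero]
    · rw [← ha, add_kronecker, smul_kronecker, kronecker_smul]

lemma IsGenuineUnitary.exists_local_diagonalization {U : MultiOp n 2} (hU : IsGenuineUnitary U)
    (hn : 2 ≤ n) {T : Fin 2 → Fin n → LocalOp 2} (hT : IsSumOfProducts U T) (i : Fin n) :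
    ∃ V ∈ unitaryGroup (Fin 2) ℂ, ∃ W ∈ unitaryGroup (Fin 2) ℂ, ∃ D : Fin 2 → Fin 2 → ℂ,
      (∀ j, V * T j i * W = diagonal (D j)) ∧ D 0 0 * D 1 1 ≠ D 0 1 * D 1 0 := by
  have hsplit : U.submatrix (splitEquiv i).symm (splitEquiv i).symm
      = ∑ j, T j i ⊗ₖ tensorErase i (T j) := by
    simp only [← submatrix_tensor_splitEquiv]
    rw [hT]
    ext x y
    simp [Matrix.sum_apply]
  have hne X Y : ∑ j, T j i ⊗ₖ tensorErase i (T j) ≠ X ⊗ₖ Y := by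
    rw [← hsplit]
    exact hU.submatrix_splitEquiv_ne_kronecker hn i X Y
  obtain ⟨hA, hP⟩ := linearIndependent_pair_of_ne_kronecker hne
  have hmem := submatrix_mem_unitaryGroup hU.1 (splitEquiv i).symm
  rw [hsplit] at hmem
  obtain ⟨V, hV, W, hW, D, hD⟩ := exists_simultaneous_diagonalization hmem hA hP
  refine ⟨V, hV, W, hW, D, hD, fun hdet => ?_⟩
  have hT' j : T j i = Vᴴ * diagonal (D j) * Wᴴ := by
    rw [← hD]
    calc T j i = (Vᴴ * V) * T j i * (W * Wᴴ) := by
          rw [show Vᴴ * V = 1 from mem_unitaryGroup_iff'.1 hV,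
            show W * Wᴴ = 1 from mem_unitaryGroup_iff.1 hW, Matrix.one_mul, Matrix.mul_one]
      _ = _ := by simp only [Matrix.mul_assoc]
  have hcomb (c : Fin 2 → ℂ) (hc : ∀ x, c 0 * D 0 x + c 1 * D 1 x = 0) : c = 0 := by
    funext j
    refine Fintype.linearIndependent_iff.1 hA c ?_ j
    have h1 : c 0 • diagonal (D 0) + c 1 • diagonal (D 1) = 0 := by
      rw [← diagonal_smul, ← diagonal_smul, diagonal_add, diagonal_eq_zero]
      funext x
      exact hc x
    rw [Fin.sum_univ_two, hT', hT']
    calc _ = Vᴴ * (c 0 • diagonal (D 0) + c 1 • diagonal (D 1)) * Wᴴ := by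
          simp [Matrix.mul_add, Matrix.add_mul]
      _ = 0 := by rw [h1]; simp
  have h1 := hcomb ![D 1 1, -D 0 1] (by
    intro x; fin_cases x <;> simp <;> first | ring1 | linear_combination hdet)
  have h2 := hcomb ![D 1 0, -D 0 0] (by
    intro x; fin_cases x <;> simp <;> first | ring1 | linear_combination -hdet)
  have h3 := hcomb ![1, 0] (by
    have e1 : D 0 1 = 0 := by simpa using congrFun h1 1
    have e2 : D 0 0 = 0 := by simpa using congrFun h2 1
    intro x; fin_cases x <;> simp [e1, e2])
  simpa using congrFun h3 0

/-- A Schmidt decomposition of length two of a genuine gate is diagonal up to local unitaries. -/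
theorem IsGenuineUnitary.exists_diagonal_decomposition {U : MultiOp n 2} (hU : IsGenuineUnitary U)
    (hn : 2 ≤ n) {T : Fin 2 → Fin n → LocalOp 2} (hT : IsSumOfProducts U T) :
    ∃ D : Fin 2 → Fin n → Fin 2 → ℂ,
      LUEquivalent U (diagonal fun x => ∑ j, ∏ i, D j i (x i)) ∧
      (∀ x : Fin n → Fin 2, ‖∑ j, ∏ i, D j i (x i)‖ = 1) ∧
      (∀ i, D 0 i 0 * D 1 i 1 ≠ D 0 i 1 * D 1 i 0) ∧
      ∀ j i, (T j i).det = 0 ↔ D j i 0 * D j i 1 = 0 := by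
  choose V hV W hW D hD hdet using hU.exists_local_diagonalization hn hT
  have hUD : (diagonal fun x : Fin n → Fin 2 => ∑ j, ∏ i, D i j (x i))
      = tensor V * U * tensor W := by
    rw [hT, Matrix.mul_sum, Matrix.sum_mul]
    simp only [tensor_mul, hD, tensor_diagonal]
    ext x y
    by_cases h : x = y
    · subst h; simp [Matrix.sum_apply]
    · simp [Matrix.sum_apply, h]
  refine ⟨fun j i => D i j, ⟨V, W, hV, hW, hUD⟩, ?_, hdet, fun j i => ?_⟩
  · apply norm_eq_one_of_diagonal_mem_unitaryGroup
    rw [hUD]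
    exact mul_mem (mul_mem (tensor_mem_unitaryGroup hV) hU.1) (tensor_mem_unitaryGroup hW)
  · have h1 := congrArg det (hD i j)
    rw [det_mul, det_mul, det_diagonal, Fin.prod_univ_two] at h1
    have hne {M : LocalOp 2} (hM : M ∈ unitaryGroup (Fin 2) ℂ) : M.det ≠ 0 := by
      intro h
      have := congrArg det (mem_unitaryGroup_iff.1 hM)
      rw [det_mul, h] at this
      simp at this
    rw [← h1]
    simp [hne (hV i), hne (hW i)]

end Genuine

end MultiOp

section Phases

lemma norm_phase (t : ℝ) : ‖phase t‖ = 1 := Complex.norm_exp_ofReal_mul_I t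

lemma phase_ne_zero (t : ℝ) : phase t ≠ 0 := Complex.exp_ne_zero _

lemma phase_add (s t : ℝ) : phase (s + t) = phase s * phase t := by
  simp [phase, add_mul, Complex.exp_add]

lemma phase_neg (t : ℝ) : phase (-t) = (phase t)⁻¹ := by
  simp [phase, Complex.exp_neg]

lemma phase_sub (s t : ℝ) : phase (s - t) = phase s / phase t := by
  rw [sub_eq_add_neg, phase_add, phase_neg, div_eq_mul_inv]

lemma phase_zero : phase 0 = 1 := by simp [phase]

lemma phase_pi : phase Real.pi = -1 := by simp [phase]

lemma phase_two_pi : phase (2 * Real.pi) = 1 := by simp [phase]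

lemma phase_eq_cos_add_sin (t : ℝ) : phase t = Real.cos t + Real.sin t * Complex.I := by
  simp [phase, Complex.exp_mul_I]

lemma exists_phase_eq {z : ℂ} (hz : ‖z‖ = 1) :
    ∃ t ∈ Set.Ico 0 (2 * Real.pi), phase t = z := by
  have h : phase z.arg = z := by
    have := Complex.norm_mul_exp_arg_mul_I z
    rwa [hz, Complex.ofReal_one, one_mul] at this
  by_cases h0 : 0 ≤ z.arg
  · exact ⟨z.arg, ⟨h0, by linarith [Complex.arg_le_pi z, Real.pi_pos]⟩, h⟩
  · refine ⟨z.arg + 2 * Real.pi, ⟨by linarith [Complex.neg_pi_lt_arg z, Real.pi_pos],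
      by linarith⟩, ?_⟩
    rw [phase_add, h, phase_two_pi, mul_one]

lemma exists_phase_eq_of_ne_one {z : ℂ} (hz : ‖z‖ = 1) (h1 : z ≠ 1) :
    ∃ t ∈ Set.Ioo 0 (2 * Real.pi), phase t = z := by
  obtain ⟨t, ⟨h0, ht⟩, rfl⟩ := exists_phase_eq hz
  refine ⟨t, ⟨lt_of_le_of_ne h0 ?_, ht⟩, rfl⟩
  rintro rfl
  exact h1 phase_zero

lemma mul_conj_of_norm_eq_one {z : ℂ} (hz : ‖z‖ = 1) : z * (starRingEnd ℂ) z = 1 := by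
  rw [Complex.mul_conj, Complex.normSq_eq_norm_sq, hz]; simp

/-- The phase of twice the argument of a number off the imaginary axis. -/
lemma phase_two_mul_arctan {w : ℂ} (hw : w.re ≠ 0) :
    phase (2 * Real.arctan (w.im / w.re)) = w / (starRingEnd ℂ) w := by
  obtain ⟨t, ht⟩ : ∃ t, t = Real.arctan (w.im / w.re) := ⟨_, rfl⟩
  have hcos : Real.cos t ≠ 0 := by rw [ht]; exact (Real.cos_arctan_pos _).ne'
  have htan : Real.sin t * w.re = w.im * Real.cos t := by
    have h := Real.tan_arctan (w.im / w.re)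
    rw [← ht, Real.tan_eq_sin_div_cos, div_eq_div_iff hcos hw] at h
    exact h
  have hw0 : (starRingEnd ℂ) w ≠ 0 := by
    intro h
    apply hw
    have := congrArg Complex.re h
    simpa using this
  have hph : (Real.cos t : ℂ) * w = w.re * phase t := by
    rw [phase_eq_cos_add_sin]
    have : w = w.re + w.im * Complex.I := (Complex.re_add_im w).symm
    have h2 : (Real.sin t : ℂ) * w.re = w.im * Real.cos t := by exact_mod_cast htan
    calc (Real.cos t : ℂ) * w = Real.cos t * (w.re + w.im * Complex.I) := by rw [← this]
      _ = _ := by linear_combination -Complex.I * h2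
  have hph' : (Real.cos t : ℂ) * (starRingEnd ℂ) w = w.re * (phase t)⁻¹ := by
    have := congrArg (starRingEnd ℂ) hph
    rw [map_mul, map_mul, Complex.conj_ofReal, Complex.conj_ofReal] at this
    rw [this, eq_inv_of_mul_eq_one_right (mul_conj_of_norm_eq_one (norm_phase t))]
  have hcosC : (Real.cos t : ℂ) ≠ 0 := by exact_mod_cast hcos
  have hwC : (w.re : ℂ) ≠ 0 := by exact_mod_cast hw
  have h0 := phase_ne_zero t
  rw [← ht, two_mul, phase_add, eq_div_iff hw0]
  apply mul_left_cancel₀ hcosC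
  calc (Real.cos t : ℂ) * (phase t * phase t * (starRingEnd ℂ) w)
      = phase t * phase t * (Real.cos t * (starRingEnd ℂ) w) := by ring
    _ = w.re * phase t := by rw [hph']; field_simp
    _ = _ := hph.symm

/-- Two points `p`, `q` on the circle of centre `-c` and radius one which a factor `r` maps to the
same circle are reflections of each other in the line of centres of this circle and its image. -/
lemma reflection_on_circle {c : ℝ} (hc : c ≠ 0) {p q r : ℂ} (hp : ‖p + c‖ = 1) (hq : ‖q + c‖ = 1)
    (hpr : ‖p * r + c‖ = 1) (hqr : ‖q * r + c‖ = 1) (hpq : p ≠ q) (hr : r ≠ 1) :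
    (q + c) * (p * r) = c * (p * r + c) - 1 := by
  have hP := mul_conj_of_norm_eq_one hp
  have hQ := mul_conj_of_norm_eq_one hq
  have hR := mul_conj_of_norm_eq_one hpr
  have hS := mul_conj_of_norm_eq_one hqr
  simp only [map_add, map_mul, Complex.conj_ofReal] at hP hQ hR hS
  generalize (starRingEnd ℂ) p = p' at *
  generalize (starRingEnd ℂ) q = q' at *
  generalize (starRingEnd ℂ) r = r' at *
  have hcC : (c : ℂ) ≠ 0 := by exact_mod_cast hc
  generalize (c : ℂ) = c at *
  have hdiff : p' - q' = -(p - q) * (p' + c) * (q' + c) := by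
    linear_combination (q' + c) * hP - (p' + c) * hQ
  have h1 : r * (r' - 1) + r' * (r - 1) * (-(p' + c) * (q' + c)) = 0 := by
    apply mul_left_cancel₀ (sub_ne_zero.2 hpq)
    apply mul_left_cancel₀ hcC
    linear_combination r * r' * (hP - hQ) - (hR - hS) - c * r' * (r - 1) * hdiff
  have h2 : r * (r' - 1) * ((p + c) * (q + c)) = r' * (r - 1) := by
    linear_combination ((p + c) * (q + c)) * h1 + r' * (r - 1) * ((q + c) * (q' + c)) * hP
      + r' * (r - 1) * hQ
  have hdiff' : (r' - 1) * p' * ((p + c) * (p * r + c)) = -((r - 1) * p) := by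
    linear_combination (p + c) * hR - (p * r + c) * hP
  have h3 : (q + c) * (p * r) = -((p * r + c) * (p' * r')) := by
    apply mul_left_cancel₀ (sub_ne_zero.2 hr)
    linear_combination r * (q + c) * hdiff' - (p * r + c) * p' * h2
  rw [h3]
  linear_combination -hR

/-- Classification of the pairs of points on a circle of centre `-c` and radius one which are
mapped to this circle by a common factor. -/
lemma exists_phases_of_circle {c : ℝ} (hc : 0 < c) {p q r : ℂ} (hp : ‖p + c‖ = 1)
    (hq : ‖q + c‖ = 1) (hpr : ‖p * r + c‖ = 1) (hqr : ‖q * r + c‖ = 1) (hp0 : p ≠ 0) (hq0 : q ≠ 0)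
    (hr0 : r ≠ 0) (hpq : p ≠ q) (hr : r ≠ 1) :
    c ≠ 1 ∧
    ((∃ α : ℝ, α ∈ Set.Ioo 0 Real.pi ∪ Set.Ioo Real.pi (2 * Real.pi) ∧ c * Real.cos α ≠ 1 ∧
      p = phase α - c ∧ q = phase (-α) - c ∧
      r = (((c ^ 2 - 1) / (1 + c ^ 2 - 2 * c * Real.cos α) : ℝ) : ℂ)) ∨
    (∃ α γ θ : ℝ, α ∈ Set.Ico 0 (2 * Real.pi) ∧ γ ∈ Set.Ico 0 (2 * Real.pi) ∧
      c * Real.cos ((α + γ) / 2) - Real.cos ((α - γ) / 2) ≠ 0 ∧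
      θ = 2 * Real.arctan ((c * Real.sin ((α + γ) / 2) - Real.sin ((α - γ) / 2)) /
        (c * Real.cos ((α + γ) / 2) - Real.cos ((α - γ) / 2))) ∧
      α ≠ γ ∧ α ≠ (Real.pi + θ) / 2 ∧ α ≠ (3 * Real.pi + θ) / 2 ∧
      p = phase α - c ∧ q = -phase (θ - α) - c ∧ r = (phase γ - c) / (phase α - c))) := by
  have hrefl := reflection_on_circle hc.ne' hp hq hpr hqr hpq hr
  have hpr0 : p * r ≠ 0 := mul_ne_zero hp0 hr0
  have hc1 : c ≠ 1 := by
    rintro rfl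
    have : q * (p * r) = 0 := by push_cast at hrefl; linear_combination hrefl
    exact mul_ne_zero hq0 hpr0 this
  refine ⟨hc1, ?_⟩
  obtain ⟨α, hα, hP⟩ := exists_phase_eq hp
  obtain ⟨γ, hγ, hR⟩ := exists_phase_eq hpr
  have hpα : p = phase α - c := by rw [hP]; ring
  have hprγ : p * r = phase γ - c := by rw [hR]; ring
  have hα0 := phase_ne_zero α
  have hγ0 := phase_ne_zero γ
  have hrval : r = (phase γ - c) / (phase α - c) := by
    rw [← hpα, ← hprγ]; field_simp
  obtain ⟨w, hw⟩ : ∃ w : ℂ, w = c * phase ((α + γ) / 2) - phase ((α - γ) / 2) := ⟨_, rfl⟩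
  have hwre : w.re = c * Real.cos ((α + γ) / 2) - Real.cos ((α - γ) / 2) := by
    rw [hw, phase_eq_cos_add_sin, phase_eq_cos_add_sin]
    simp [-Complex.ofReal_cos, -Complex.ofReal_sin]
  have hwim : w.im = c * Real.sin ((α + γ) / 2) - Real.sin ((α - γ) / 2) := by
    rw [hw, phase_eq_cos_add_sin, phase_eq_cos_add_sin]
    simp [-Complex.ofReal_cos, -Complex.ofReal_sin]
  have hconj (t : ℝ) : (starRingEnd ℂ) (phase t) = (phase t)⁻¹ :=
    eq_inv_of_mul_eq_one_right (mul_conj_of_norm_eq_one (norm_phase t))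
  have hα2 : phase α = phase (α / 2) * phase (α / 2) := by rw [← phase_add]; congr 1; ring
  have hγ2 : phase γ = phase (γ / 2) * phase (γ / 2) := by rw [← phase_add]; congr 1; ring
  have hw' : w = c * (phase (α / 2) * phase (γ / 2)) - phase (α / 2) / phase (γ / 2) := by
    rw [hw, ← phase_add, ← phase_sub]; ring_nf
  have hwconj : (starRingEnd ℂ) w =
      c * ((phase (α / 2))⁻¹ * (phase (γ / 2))⁻¹) - phase (γ / 2) / phase (α / 2) := by
    rw [hw', map_sub, map_mul, map_mul, map_div₀, hconj, hconj, Complex.conj_ofReal]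
    have := phase_ne_zero (α / 2)
    have := phase_ne_zero (γ / 2)
    field_simp
  have hwQ : w = -(phase α * (q + c)) * (starRingEnd ℂ) w := by
    rw [hwconj, hw']
    have h1 := phase_ne_zero (α / 2)
    have h2 := phase_ne_zero (γ / 2)
    rw [← sub_add_cancel (p * r) (p * r), sub_self, zero_add, hprγ] at hrefl
    rw [hγ2] at hrefl
    rw [hα2]
    field_simp
    linear_combination -hrefl
  have hcR : (c : ℂ) * phase γ - 1 ≠ 0 := by
    intro h
    have h1 : ‖(c : ℂ) * phase γ‖ = 1 := by rw [sub_eq_zero.1 h]; simp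
    rw [norm_mul, norm_phase, mul_one, Complex.norm_real, Real.norm_of_nonneg hc.le] at h1
    exact hc1 h1
  have hw0 : w ≠ 0 := by
    intro h
    apply hcR
    have h2 := phase_ne_zero (γ / 2)
    have h1 : w * phase (γ / 2) = phase (α / 2) * (c * phase γ - 1) := by
      rw [hw', hγ2]; field_simp
    rw [h, zero_mul, eq_comm] at h1
    exact (mul_eq_zero.1 h1).resolve_left (phase_ne_zero _)
  have hwc0 : (starRingEnd ℂ) w ≠ 0 := by simpa using hw0
  have hαγ : α ≠ γ := by
    rintro rfl
    apply hr
    rw [hrval, div_self]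
    rwa [← hpα]
  by_cases hre : w.re = 0
  · left
    have hwc : (starRingEnd ℂ) w = -w := by
      apply Complex.ext <;> simp [hre]
    have hPQ : phase α * (q + c) = 1 := by
      rw [hwc] at hwQ
      apply mul_left_cancel₀ hw0
      linear_combination -hwQ
    have hqα : q = phase (-α) - c := by
      rw [phase_neg, ← eq_inv_of_mul_eq_one_right hPQ]; ring
    have hcos : 2 * (Real.cos α : ℂ) = phase α + (phase α)⁻¹ := by
      rw [← phase_neg, phase_eq_cos_add_sin, phase_eq_cos_add_sin, Real.cos_neg, Real.sin_neg]
      push_cast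
      ring
    have hden : (1 + (c : ℂ) ^ 2 - 2 * c * Real.cos α) = p * q := by
      rw [hpα, hqα, phase_neg]
      field_simp
      linear_combination (-(c : ℂ) * phase α) * hcos
        - c * (mul_inv_cancel₀ hα0)
    have hpqr : p * q * r = (c : ℂ) ^ 2 - 1 := by linear_combination hrefl
    have hrr : r = (((c ^ 2 - 1) / (1 + c ^ 2 - 2 * c * Real.cos α) : ℝ) : ℂ) := by
      rw [Complex.ofReal_div]
      simp only [Complex.ofReal_sub, Complex.ofReal_add, Complex.ofReal_mul, Complex.ofReal_pow,
        Complex.ofReal_one, Complex.ofReal_ofNat]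
      rw [hden, ← hpqr]
      field_simp
    refine ⟨α, ?_, ?_, hpα, hqα, hrr⟩
    · have h0 : α ≠ 0 := by
        rintro rfl
        apply hpq
        rw [hpα, hqα, neg_zero]
      have hπ : α ≠ Real.pi := by
        rintro rfl
        apply hpq
        rw [hpα, hqα, phase_neg, phase_pi]; norm_num
      rcases lt_or_gt_of_ne hπ with h | h
      · exact Or.inl ⟨lt_of_le_of_ne hα.1 h0.symm, h⟩
      · exact Or.inr ⟨h, hα.2⟩
    · intro h
      apply hr
      have h1 : (c : ℂ) * Real.cos α = 1 := by exact_mod_cast h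
      have h2 : p * q = (c : ℂ) ^ 2 - 1 := by rw [← hden]; linear_combination -2 * h1
      apply mul_left_cancel₀ (mul_ne_zero hp0 hq0)
      rw [hpqr, h2, mul_one]
  · right
    have hθ := phase_two_mul_arctan hre
    have hθ' : phase (2 * Real.arctan (w.im / w.re)) = -(phase α * (q + c)) := by
      rw [hθ, div_eq_iff hwc0]; exact hwQ
    rw [hwre] at hre
    rw [hwre, hwim] at hθ'
    obtain ⟨θ, hθdef⟩ : ∃ θ, θ = 2 * Real.arctan
        ((c * Real.sin ((α + γ) / 2) - Real.sin ((α - γ) / 2)) /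
          (c * Real.cos ((α + γ) / 2) - Real.cos ((α - γ) / 2))) := ⟨_, rfl⟩
    rw [← hθdef] at hθ'
    refine ⟨α, γ, θ, hα, hγ, hre, hθdef, hαγ, ?_, ?_, hpα, ?_, hrval⟩
    · intro h
      have h1 : phase α * phase α = phase Real.pi * phase θ := by
        rw [← phase_add, ← phase_add]; congr 1; linarith
      rw [hθ', phase_pi] at h1
      have h2 : phase α = q + c := mul_left_cancel₀ hα0 (by linear_combination h1)
      exact hpq (by rw [hpα, h2]; ring)
    · intro h
      have h1 : phase α * phase α = phase (2 * Real.pi) * phase Real.pi * phase θ := by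
        rw [← phase_add, ← phase_add, ← phase_add]; congr 1; linarith
      rw [hθ', phase_pi, phase_two_pi] at h1
      have h2 : phase α = q + c := mul_left_cancel₀ hα0 (by linear_combination h1)
      exact hpq (by rw [hpα, h2]; ring)
    · rw [phase_sub, hθ']
      field_simp
      ring

end Phases

namespace MultiOp

open Matrix

section ThreeQubits

/-- Up to a permutation of the qubits and local unitaries, `U` is the sum of the tensor products of
the diagonal matrices with entries `a i` and of those with entries `b i`. -/
structure IsDiagonalModel (U : MultiOp 3 2) (a b : Fin 3 → Fin 2 → ℂ) : Prop where
  permLUEquivalent : PermLUEquivalent U (diagonal fun x => ∏ i, a i (x i) + ∏ i, b i (x i))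
  norm_eq_one : ∀ x y z, ‖a 0 x * a 1 y * a 2 z + b 0 x * b 1 y * b 2 z‖ = 1
  det_ne : ∀ i, a i 0 * b i 1 ≠ a i 1 * b i 0

variable {U : MultiOp 3 2} {a b : Fin 3 → Fin 2 → ℂ}

lemma IsDiagonalModel.swap (h : IsDiagonalModel U a b) : IsDiagonalModel U b a where
  permLUEquivalent := by simpa only [add_comm] using h.permLUEquivalent
  norm_eq_one x y z := by rw [add_comm]; exact h.norm_eq_one x y z
  det_ne i h' := h.det_ne i (by linear_combination -h')

lemma IsDiagonalModel.rephase (h : IsDiagonalModel U a b) {a' b' u : Fin 3 → Fin 2 → ℂ}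
    (hu : ∀ i x, ‖u i x‖ = 1) (hdet : ∀ i, a' i 0 * b' i 1 ≠ a' i 1 * b' i 0)
    (heq : ∀ x y z, a' 0 x * a' 1 y * a' 2 z + b' 0 x * b' 1 y * b' 2 z =
      u 0 x * u 1 y * u 2 z * (a 0 x * a 1 y * a 2 z + b 0 x * b 1 y * b 2 z)) :
    IsDiagonalModel U a' b' where
  permLUEquivalent := by
    convert h.permLUEquivalent.trans
      (LUEquivalent.diagonal_relabel _ (fun _ => 1) u hu).permLUEquivalent using 3 with x
    simp only [Fin.prod_univ_three, Equiv.Perm.one_apply]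
    exact heq _ _ _
  norm_eq_one x y z := by
    rw [heq, norm_mul, norm_mul, norm_mul, hu, hu, hu, h.norm_eq_one]; simp
  det_ne := hdet

lemma IsDiagonalModel.flip (h : IsDiagonalModel U a b) (τ : Fin 3 → Equiv.Perm (Fin 2)) :
    IsDiagonalModel U (fun i x => a i (τ i x)) (fun i x => b i (τ i x)) where
  permLUEquivalent := by
    convert h.permLUEquivalent.trans
      (LUEquivalent.diagonal_relabel _ τ (fun _ _ => 1) (by simp)).permLUEquivalent using 3 with x
    simp
  norm_eq_one x y z := h.norm_eq_one _ _ _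
  det_ne i := by
    have hτ : ∀ σ : Equiv.Perm (Fin 2), σ 0 = 0 ∧ σ 1 = 1 ∨ σ 0 = 1 ∧ σ 1 = 0 := by decide
    rcases hτ (τ i) with ⟨h0, h1⟩ | ⟨h0, h1⟩
    · rw [h0, h1]; exact h.det_ne i
    · rw [h0, h1]; exact fun h' => h.det_ne i (by linear_combination -h')

lemma IsDiagonalModel.permute (h : IsDiagonalModel U a b) (σ : Equiv.Perm (Fin 3)) :
    IsDiagonalModel U (fun i => a (σ i)) (fun i => b (σ i)) where
  permLUEquivalent := by
    refine h.permLUEquivalent.trans ⟨σ⁻¹, fun _ => 1, fun _ => 1, fun _ => one_mem _,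
      fun _ => one_mem _, ?_⟩
    rw [tensor_one, Matrix.one_mul, Matrix.mul_one]
    have hprod (f : Fin 3 → Fin 2 → ℂ) (x : Fin 3 → Fin 2) :
        ∏ i, f i ((x ∘ (σ⁻¹ : Equiv.Perm (Fin 3))) i) = ∏ i, f (σ i) (x i) :=
      (Fintype.prod_equiv σ _ _ (by simp)).symm
    have hinj : Function.Injective
        (fun x : Fin 3 → Fin 2 => x ∘ (σ⁻¹ : Equiv.Perm (Fin 3))) :=
      (σ⁻¹ : Equiv.Perm (Fin 3)).surjective.injective_comp_right
    ext x y
    rw [permuteSystems, submatrix_apply]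
    by_cases hxy : x = y
    · subst hxy
      rw [diagonal_apply_eq, diagonal_apply_eq, hprod, hprod]
    · rw [diagonal_apply_ne _ hxy, diagonal_apply_ne _ fun h' => hxy (hinj h')]
  norm_eq_one x y z := by
    obtain ⟨w, hw⟩ : ∃ w : Fin 3 → Fin 2, ∀ i, w (σ i) = ![x, y, z] i :=
      ⟨fun j => ![x, y, z] (σ.symm j), by simp⟩
    have hprod (f : Fin 3 → Fin 2 → ℂ) :
        f (σ 0) x * f (σ 1) y * f (σ 2) z = f 0 (w 0) * f 1 (w 1) * f 2 (w 2) := by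
      have h1 : ∏ i, f (σ i) (w (σ i)) = ∏ i, f i (w i) := Fintype.prod_equiv σ _ _ (by simp)
      rw [Fin.prod_univ_three, Fin.prod_univ_three, hw, hw, hw] at h1
      exact h1
    rw [hprod, hprod]
    exact h.norm_eq_one _ _ _
  det_ne i := h.det_ne (σ i)

lemma IsDiagonalModel.hasSchmidtForm (h : IsDiagonalModel U a b) (hr : schmidtRank U = 2)
    {A B : Fin 3 → LocalOp 2} (a' b' : Fin 3 → Fin 2 → ℂ) (hA : ∀ i, A i = diagonal (a' i))
    (hB : ∀ i, B i = diagonal (b' i))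
    (heq : ∀ x y z, a' 0 x * a' 1 y * a' 2 z + b' 0 x * b' 1 y * b' 2 z =
      a 0 x * a 1 y * a 2 z + b 0 x * b 1 y * b 2 z) : HasSchmidtForm U A B := by
  obtain rfl : A = fun i => diagonal (a' i) := funext hA
  obtain rfl : B = fun i => diagonal (b' i) := funext hB
  refine PermLUEquivalent.hasSchmidtForm ?_ hr
  have hF : (fun x : Fin 3 → Fin 2 => ∏ i, a' i (x i) + ∏ i, b' i (x i)) =
      fun x => ∏ i, a i (x i) + ∏ i, b i (x i) := by
    funext x
    simp only [Fin.prod_univ_three]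
    exact heq _ _ _
  rw [tensor_diagonal, tensor_diagonal, diagonal_add, hF]
  exact h.permLUEquivalent

lemma IsDiagonalModel.ne_zero_of_eq_zero (h : IsDiagonalModel U a b) {i j : Fin 3} (hij : i ≠ j)
    {x : Fin 2} (hx : a i x = 0) (y : Fin 2) : b j y ≠ 0 := by
  intro hy
  obtain ⟨w, hwi, hwj⟩ : ∃ w : Fin 3 → Fin 2, w i = x ∧ w j = y :=
    ⟨Function.update (fun _ => y) i x, by simp, by simp [hij.symm]⟩
  have h1 : ∏ k, a k (w k) = 0 := Finset.prod_eq_zero (Finset.mem_univ i) (by rw [hwi, hx])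
  have h2 : ∏ k, b k (w k) = 0 := Finset.prod_eq_zero (Finset.mem_univ j) (by rw [hwj, hy])
  have h3 := h.norm_eq_one (w 0) (w 1) (w 2)
  rw [Fin.prod_univ_three] at h1 h2
  rw [h1, h2] at h3
  simp at h3

/-- The number of singular matrices among the `diag (a i)`. -/
noncomputable def singularCount (a : Fin 3 → Fin 2 → ℂ) : ℕ := by
  classical exact (Finset.univ.filter fun i => a i 0 * a i 1 = 0).card

lemma numSingular_eq_add {T : Fin 2 → Fin 3 → LocalOp 2} {D : Fin 2 → Fin 3 → Fin 2 → ℂ}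
    (h : ∀ j i, (T j i).det = 0 ↔ D j i 0 * D j i 1 = 0) :
    numSingular T = singularCount (D 0) + singularCount (D 1) := by
  classical
  simp only [numSingular, h, singularCount]
  rw [Nat.card_eq_fintype_card, Fintype.card_subtype, Finset.card_filter, Fintype.sum_prod_type,
    Fin.sum_univ_two, Finset.card_filter, Finset.card_filter]

/-- The singular local operators all belong to the first product operator and come first. -/
structure IsSortedModel (U : MultiOp 3 2) (k : ℕ) (a b : Fin 3 → Fin 2 → ℂ) : Prop where
  isDiagonalModel : IsDiagonalModel U a b
  singular : ∀ i : Fin 3, i.val < k → a i 1 = 0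
  ne_zero_left : ∀ i : Fin 3, a i 0 ≠ 0
  ne_zero_right : ∀ i : Fin 3, k ≤ i.val → a i 1 ≠ 0
  ne_zero : ∀ i x, b i x ≠ 0

lemma IsDiagonalModel.exists_isSortedModel (h : IsDiagonalModel U a b) (hb : ∀ i x, b i x ≠ 0) :
    singularCount a ≤ 3 ∧ ∃ a' b', IsSortedModel U (singularCount a) a' b' := by
  classical
  have hperm : ∀ S : Finset (Fin 3), ∃ σ : Equiv.Perm (Fin 3), ∀ i : Fin 3,
      i.val < S.card ↔ σ i ∈ S := by decide
  obtain ⟨S, hS⟩ : ∃ S, S = Finset.univ.filter fun i => a i 0 * a i 1 = 0 := ⟨_, rfl⟩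
  have hmem i : i ∈ S ↔ a i 0 * a i 1 = 0 := by simp [hS]
  have hk : singularCount a = S.card := by rw [hS, singularCount]
  rw [hk]
  refine ⟨by simpa using Finset.card_le_univ S, ?_⟩
  obtain ⟨σ, hσ⟩ := hperm S
  have h1 := (h.permute σ).flip (fun i => if a (σ i) 0 = 0 then Equiv.swap 0 1 else 1)
  refine ⟨_, _, h1, fun i hi => ?_, fun i => ?_, fun i hi => ?_, fun i x => hb _ _⟩
  · have h2 := (hmem _).1 ((hσ i).1 hi)
    split_ifs with h0
    · simpa using h0
    · simpa using (mul_eq_zero.1 h2).resolve_left h0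
  · have hdet := h.det_ne (σ i)
    split_ifs with h0
    · rw [Equiv.swap_apply_left]
      intro h3
      rw [h0, h3] at hdet
      simp at hdet
    · simpa using h0
  · have h2 : ¬ a (σ i) 0 * a (σ i) 1 = 0 := fun h3 => by
      have := (hσ i).2 ((hmem _).2 h3)
      omega
    rw [mul_eq_zero, not_or] at h2
    rw [if_neg h2.1]
    exact h2.2

/-- Either the two singular operators act on the same qubit, or all the singular operators belong
to the same product operator. -/
lemma IsDiagonalModel.exists_normalForm (h : IsDiagonalModel U a b) :
    (singularCount a + singularCount b = 2 ∧ ∃ a' b', IsDiagonalModel U a' b' ∧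
      a' 0 1 = 0 ∧ b' 0 0 = 0 ∧ (∀ i x, i ≠ 0 → a' i x ≠ 0 ∧ b' i x ≠ 0)) ∨
    (singularCount a + singularCount b ≤ 3 ∧
      ∃ a' b', IsSortedModel U (singularCount a + singularCount b) a' b') := by
  have hperm : ∀ x y : Fin 2, x ≠ y → ∃ τ : Equiv.Perm (Fin 2), τ 0 = y ∧ τ 1 = x := by decide
  classical
  have key {a b : Fin 3 → Fin 2 → ℂ} (h : IsDiagonalModel U a b) (hb : ∀ i x, b i x ≠ 0) :
      singularCount a + singularCount b ≤ 3 ∧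
        ∃ a' b', IsSortedModel U (singularCount a + singularCount b) a' b' := by
    have hb0 : singularCount b = 0 := by
      rw [singularCount, Finset.card_eq_zero, Finset.filter_eq_empty_iff]
      exact fun i _ => mul_ne_zero (hb i 0) (hb i 1)
    rw [hb0, add_zero]
    exact h.exists_isSortedModel hb
  by_cases hb : ∀ i x, b i x ≠ 0
  · exact Or.inr (key h hb)
  by_cases ha : ∀ i x, a i x ≠ 0
  · right
    rw [add_comm]
    exact key h.swap ha
  left
  push Not at ha hb
  obtain ⟨i, x, hx⟩ := ha
  obtain ⟨j, y, hy⟩ := hb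
  obtain rfl : i = j := by
    by_contra hij
    exact h.ne_zero_of_eq_zero hij hx y hy
  have hbne j (hj : j ≠ i) y : b j y ≠ 0 := h.ne_zero_of_eq_zero hj.symm hx y
  have hane j (hj : j ≠ i) y : a j y ≠ 0 := h.swap.ne_zero_of_eq_zero hj.symm hy y
  have hcount {f : Fin 3 → Fin 2 → ℂ} {x : Fin 2} (hf : ∀ j, j ≠ i → ∀ y, f j y ≠ 0)
      (hx : f i x = 0) : singularCount f = 1 := by
    rw [singularCount, Finset.card_eq_one]
    refine ⟨i, ?_⟩
    ext j
    simp only [Finset.mem_filter, Finset.mem_univ, true_and, Finset.mem_singleton]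
    constructor
    · intro hj
      by_contra hne
      exact mul_ne_zero (hf j hne 0) (hf j hne 1) hj
    · rintro rfl
      fin_cases x
      · exact mul_eq_zero_of_left hx _
      · exact mul_eq_zero_of_right _ hx
  refine ⟨by rw [hcount hane hx, hcount hbne hy], ?_⟩
  have hxy : x ≠ y := by
    rintro rfl
    apply h.det_ne i
    fin_cases x
    · rw [show a i 0 = 0 from hx, show b i 0 = 0 from hy]; simp
    · rw [show a i 1 = 0 from hx, show b i 1 = 0 from hy]; simp
  obtain ⟨τ, hτ0, hτ1⟩ := hperm x y hxy
  refine ⟨_, _, (h.permute (Equiv.swap 0 i)).flip (fun _ => τ), ?_, ?_, fun j z hj => ?_⟩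
  · simpa [hτ1] using hx
  · simpa [hτ0] using hy
  · have hne : Equiv.swap 0 i j ≠ i := by
      intro h'
      apply hj
      have := congrArg (Equiv.swap 0 i) h'
      simpa using this
    exact ⟨hane _ hne _, hbne _ hne _⟩

end ThreeQubits

end MultiOp

namespace MultiOp

open Matrix

section Classification

variable {U : MultiOp 3 2} {a b : Fin 3 → Fin 2 → ℂ}

/-- If two local operators of the first term vanish on the last basis vector, then the second term
is unitary, and it can be normalized to the identity. -/
lemma IsDiagonalModel.normalize_right (h : IsDiagonalModel U a b) (h0 : a 0 1 = 0) (h1 : a 1 1 = 0)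
    (hb : ∀ i x, b i x ≠ 0) : IsDiagonalModel U (fun i x => a i x / b i x) (fun _ _ => 1) := by
  have hn0 x : ‖b 0 x * b 1 1 * b 2 1‖ = 1 := by simpa [h1] using h.norm_eq_one x 1 1
  have hn1 y : ‖b 0 1 * b 1 y * b 2 1‖ = 1 := by simpa [h0] using h.norm_eq_one 1 y 1
  have hn2 z : ‖b 0 1 * b 1 1 * b 2 z‖ = 1 := by simpa [h0] using h.norm_eq_one 1 1 z
  refine h.rephase (u := ![fun x => (b 0 x * b 1 1 * b 2 1)⁻¹,
    fun y => (b 0 1 * b 1 1 * b 2 1) / (b 0 1 * b 1 y * b 2 1),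
    fun z => (b 0 1 * b 1 1 * b 2 1) / (b 0 1 * b 1 1 * b 2 z)]) ?_ ?_ ?_
  · intro i x
    fin_cases i
    · show ‖(b 0 x * b 1 1 * b 2 1)⁻¹‖ = 1
      rw [norm_inv, hn0, inv_one]
    · show ‖(b 0 1 * b 1 1 * b 2 1) / (b 0 1 * b 1 x * b 2 1)‖ = 1
      rw [norm_div, hn0, hn1, div_one]
    · show ‖(b 0 1 * b 1 1 * b 2 1) / (b 0 1 * b 1 1 * b 2 x)‖ = 1
      rw [norm_div, hn0, hn2, div_one]
  · intro i h'
    rw [mul_one, mul_one, div_eq_div_iff (hb _ _) (hb _ _)] at h'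
    exact h.det_ne i h'
  · intro x y z
    have := hb 0 x
    have := hb 1 y
    have := hb 2 z
    have := hb 0 1
    have := hb 1 1
    have := hb 2 1
    show _ = (b 0 x * b 1 1 * b 2 1)⁻¹ * ((b 0 1 * b 1 1 * b 2 1) / (b 0 1 * b 1 y * b 2 1)) *
      ((b 0 1 * b 1 1 * b 2 1) / (b 0 1 * b 1 1 * b 2 z)) * _
    field_simp

lemma one_eq_diagonal_one : (1 : LocalOp 2) = diagonal (fun _ => 1) := diagonal_one.symm

/-- Gates with singular number three. -/
lemma IsSortedModel.hasSchmidtForm_three (h : IsSortedModel U 3 a b) (hr : schmidtRank U = 2) :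
    ∃ φ : ℝ, φ ∈ Set.Ioo 0 (2 * Real.pi) ∧
      HasSchmidtForm U ![1, 1, 1] ![(phase φ - 1) • qdiag 1 0, qdiag 1 0, qdiag 1 0] := by
  have h0 := h.singular 0 (by decide)
  have h1 := h.singular 1 (by decide)
  have h2 := h.singular 2 (by decide)
  have hm := h.isDiagonalModel.normalize_right h0 h1 h.ne_zero
  obtain ⟨a', ha'⟩ : ∃ a', a' = fun i x => a i x / b i x := ⟨_, rfl⟩
  have ha0 i : a' i 0 ≠ 0 := by rw [ha']; exact div_ne_zero (h.ne_zero_left i) (h.ne_zero i 0)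
  have ha1 : a' 0 1 = 0 ∧ a' 1 1 = 0 ∧ a' 2 1 = 0 := by simp [ha', h0, h1, h2]
  rw [← ha'] at hm
  obtain ⟨φ, hφ, hφe⟩ := exists_phase_eq_of_ne_one (hm.norm_eq_one 0 0 0) (by
    intro h'
    have : a' 0 0 * a' 1 0 * a' 2 0 = 0 := by linear_combination h'
    exact mul_ne_zero (mul_ne_zero (ha0 0) (ha0 1)) (ha0 2) this)
  refine ⟨φ, hφ, hm.hasSchmidtForm hr (fun _ _ => 1)
    ![![phase φ - 1, 0], ![1, 0], ![1, 0]] ?_ ?_ ?_⟩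
  · intro i
    fin_cases i <;> exact one_eq_diagonal_one
  · intro i
    fin_cases i
    · ext x y
      fin_cases x <;> fin_cases y <;> simp [qdiag]
    · rfl
    · rfl
  · simp only [Fin.forall_fin_two]
    simp [ha1, hφe, add_comm]

/-- Gates with singular number two whose singular operators act on different qubits. -/
lemma IsSortedModel.hasSchmidtForm_two (h : IsSortedModel U 2 a b) (hr : schmidtRank U = 2) :
    ∃ θ φ : ℝ, θ ∈ Set.Ioo 0 (2 * Real.pi) ∧ φ ∈ Set.Ioo 0 (2 * Real.pi) ∧
      HasSchmidtForm U ![1, 1, 1]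
        ![qdiag 0 1, qdiag 0 1, qdiag (phase θ - 1) (phase φ - 1)] := by
  have h0 := h.singular 0 (by decide)
  have h1 := h.singular 1 (by decide)
  have h2 := h.ne_zero_right 2 (by decide)
  have hm := h.isDiagonalModel.normalize_right h0 h1 h.ne_zero
  obtain ⟨a', ha'⟩ : ∃ a', a' = fun i x => a i x / b i x := ⟨_, rfl⟩
  have ha0 i : a' i 0 ≠ 0 := by rw [ha']; exact div_ne_zero (h.ne_zero_left i) (h.ne_zero i 0)
  have ha1 : a' 0 1 = 0 ∧ a' 1 1 = 0 := by simp [ha', h0, h1]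
  have ha2 : a' 2 1 ≠ 0 := by rw [ha']; exact div_ne_zero h2 (h.ne_zero 2 1)
  rw [← ha'] at hm
  have hphase z (hz : a' 2 z ≠ 0) := exists_phase_eq_of_ne_one (hm.norm_eq_one 0 0 z) (by
    intro h'
    have : a' 0 0 * a' 1 0 * a' 2 z = 0 := by linear_combination h'
    exact mul_ne_zero (mul_ne_zero (ha0 0) (ha0 1)) hz this)
  obtain ⟨θ, hθ, hθe⟩ := hphase 0 (ha0 2)
  obtain ⟨φ, hφ, hφe⟩ := hphase 1 ha2
  refine ⟨θ, φ, hθ, hφ, (hm.flip ![Equiv.swap 0 1, Equiv.swap 0 1, 1]).hasSchmidtForm hr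
    (fun _ _ => 1) ![![0, 1], ![0, 1], ![phase θ - 1, phase φ - 1]] ?_ ?_ ?_⟩
  · intro i
    fin_cases i <;> exact one_eq_diagonal_one
  · intro i
    fin_cases i <;> rfl
  · simp only [Fin.forall_fin_two]
    simp [ha1, hθe, hφe, add_comm]

/-- Gates with singular number two whose singular operators act on the same qubit. -/
lemma IsDiagonalModel.hasSchmidtForm_controlled (h : IsDiagonalModel U a b)
    (hr : schmidtRank U = 2) (ha : a 0 1 = 0) (hb : b 0 0 = 0)
    (hne : ∀ i x, i ≠ 0 → a i x ≠ 0 ∧ b i x ≠ 0) :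
    ∃ γ δ : ℝ, γ ∈ Set.Ico 0 (2 * Real.pi) ∧ δ ∈ Set.Ico 0 (2 * Real.pi) ∧
      HasSchmidtForm U ![qdiag 1 0, 1, 1]
        ![qdiag 0 1, qdiag 1 (phase γ), qdiag 1 (phase δ)] := by
  have hna y z : ‖a 0 0 * a 1 y * a 2 z‖ = 1 := by simpa [hb] using h.norm_eq_one 0 y z
  have hnb y z : ‖b 0 1 * b 1 y * b 2 z‖ = 1 := by simpa [ha] using h.norm_eq_one 1 y z
  have ha0 : a 0 0 ≠ 0 := fun h' => by simpa [h'] using hna 0 0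
  have hb0 : b 0 1 ≠ 0 := fun h' => by simpa [h'] using hnb 0 0
  have ha1 y := (hne 1 y (by decide)).1
  have ha2 y := (hne 2 y (by decide)).1
  have hb1 y := (hne 1 y (by decide)).2
  have hb2 y := (hne 2 y (by decide)).2
  obtain ⟨γ, hγ, hγe⟩ := exists_phase_eq
    (z := (a 0 0 * a 1 0 * a 2 0) / (a 0 0 * a 1 1 * a 2 0) *
      ((b 0 1 * b 1 1 * b 2 0) / (b 0 1 * b 1 0 * b 2 0)))
    (by rw [norm_mul, norm_div, norm_div, hna, hna, hnb, hnb]; simp)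
  obtain ⟨δ, hδ, hδe⟩ := exists_phase_eq
    (z := (a 0 0 * a 1 0 * a 2 0) / (a 0 0 * a 1 0 * a 2 1) *
      ((b 0 1 * b 1 0 * b 2 1) / (b 0 1 * b 1 0 * b 2 0)))
    (by rw [norm_mul, norm_div, norm_div, hna, hna, hnb, hnb]; simp)
  have hm : IsDiagonalModel U ![![1, 0], fun _ => 1, fun _ => 1]
      ![![0, 1], ![1, phase γ], ![1, phase δ]] := by
    refine h.rephase (u := ![![(a 0 0 * a 1 0 * a 2 0)⁻¹, (b 0 1 * b 1 0 * b 2 0)⁻¹],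
      fun y => (a 0 0 * a 1 0 * a 2 0) / (a 0 0 * a 1 y * a 2 0),
      fun z => (a 0 0 * a 1 0 * a 2 0) / (a 0 0 * a 1 0 * a 2 z)]) ?_ ?_ ?_
    · intro i x
      fin_cases i
      · fin_cases x
        · show ‖(a 0 0 * a 1 0 * a 2 0)⁻¹‖ = 1
          rw [norm_inv, hna, inv_one]
        · show ‖(b 0 1 * b 1 0 * b 2 0)⁻¹‖ = 1
          rw [norm_inv, hnb, inv_one]
      · show ‖(a 0 0 * a 1 0 * a 2 0) / (a 0 0 * a 1 x * a 2 0)‖ = 1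
        rw [norm_div, hna, hna, div_one]
      · show ‖(a 0 0 * a 1 0 * a 2 0) / (a 0 0 * a 1 0 * a 2 x)‖ = 1
        rw [norm_div, hna, hna, div_one]
    · intro i
      have hd1 := h.det_ne 1
      have hd2 := h.det_ne 2
      fin_cases i
      · simp
      · show (1 : ℂ) * phase γ ≠ 1 * 1
        rw [one_mul, one_mul, hγe]
        intro h'
        have := ha1 0
        have := ha1 1
        have := ha2 0
        have := hb1 0
        have := hb2 0
        field_simp at h'
        exact hd1 h'
      · show (1 : ℂ) * phase δ ≠ 1 * 1
        rw [one_mul, one_mul, hδe]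
        intro h'
        have := ha1 0
        have := ha2 1
        have := ha2 0
        have := hb1 0
        have := hb2 0
        field_simp at h'
        exact hd2 h'
    · have := ha1 0
      have := ha1 1
      have := ha2 0
      have := ha2 1
      have := hb1 0
      have := hb1 1
      have := hb2 0
      have := hb2 1
      simp only [Fin.forall_fin_two]
      simp [ha, hb, hγe, hδe]
      field_simp
      simp
  refine ⟨γ, δ, hγ, hδ, hm.hasSchmidtForm hr _ _ ?_ ?_ fun _ _ _ => rfl⟩
  · intro i
    fin_cases i
    · rfl
    · exact one_eq_diagonal_one
    · exact one_eq_diagonal_one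
  · intro i
    fin_cases i <;> rfl

/-- Gates with singular number one, up to the choice of the remaining parameters. -/
lemma IsSortedModel.exists_model_one (h : IsSortedModel U 1 a b) :
    ∃ (c : ℝ) (p q r : ℂ), 0 < c ∧ p ≠ 0 ∧ q ≠ 0 ∧ r ≠ 0 ∧ p ≠ q ∧ r ≠ 1 ∧
      IsDiagonalModel U ![![1, 0], ![p, q], ![1, r]] ![![c, 1], fun _ => 1, fun _ => 1] := by
  have h0 := h.singular 0 (by decide)
  have hm := h.isDiagonalModel
  have hb := h.ne_zero
  have hnb y z : ‖b 0 1 * b 1 y * b 2 z‖ = 1 := by simpa [h0] using hm.norm_eq_one 1 y z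
  have ha1 := h.ne_zero_right 1 (by decide)
  have ha2 := h.ne_zero_right 2 (by decide)
  have ha := h.ne_zero_left
  obtain ⟨e, he⟩ : ∃ e, e = b 0 0 * b 1 0 * b 2 0 := ⟨_, rfl⟩
  have he0 : e ≠ 0 := by rw [he]; exact mul_ne_zero (mul_ne_zero (hb _ _) (hb _ _)) (hb _ _)
  have hc : 0 < ‖e‖ := norm_pos_iff.2 he0
  have hcC : (‖e‖ : ℂ) ≠ 0 := by exact_mod_cast hc.ne'
  have hb10 := hb 1 0
  have hb11 := hb 1 1
  have hb20 := hb 2 0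
  have hb21 := hb 2 1
  have hb00 := hb 0 0
  have hb01 := hb 0 1
  have ha00 := ha 0
  have ha10 := ha 1
  have ha20 := ha 2
  have hpq : ‖e‖ * (a 0 0 * a 1 0 * a 2 0) / e ≠
      ‖e‖ * (a 0 0 * a 1 1 * a 2 0) / e * (b 1 0 / b 1 1) := by
    intro h'
    field_simp at h'
    exact hm.det_ne 1 h'
  have hr1 : a 2 1 / a 2 0 * (b 2 0 / b 2 1) ≠ 1 := by
    intro h'
    field_simp at h'
    exact hm.det_ne 2 (by linear_combination -h')
  refine ⟨‖e‖, ‖e‖ * (a 0 0 * a 1 0 * a 2 0) / e,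
    ‖e‖ * (a 0 0 * a 1 1 * a 2 0) / e * (b 1 0 / b 1 1), a 2 1 / a 2 0 * (b 2 0 / b 2 1), hc,
    by positivity, by positivity, by positivity, hpq, hr1, ?_⟩
  refine hm.rephase (u := ![![‖e‖ / e, (b 0 1 * b 1 0 * b 2 0)⁻¹],
      fun y => (b 0 1 * b 1 0 * b 2 0) / (b 0 1 * b 1 y * b 2 0),
      fun z => (b 0 1 * b 1 0 * b 2 0) / (b 0 1 * b 1 0 * b 2 z)]) ?_ ?_ ?_
  · intro i x
    fin_cases i
    · fin_cases x
      · show ‖(‖e‖ : ℂ) / e‖ = 1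
        rw [norm_div, Complex.norm_real, norm_norm, div_self hc.ne']
      · show ‖(b 0 1 * b 1 0 * b 2 0)⁻¹‖ = 1
        rw [norm_inv, hnb, inv_one]
    · show ‖(b 0 1 * b 1 0 * b 2 0) / (b 0 1 * b 1 x * b 2 0)‖ = 1
      rw [norm_div, hnb, hnb, div_one]
    · show ‖(b 0 1 * b 1 0 * b 2 0) / (b 0 1 * b 1 0 * b 2 x)‖ = 1
      rw [norm_div, hnb, hnb, div_one]
  · intro i
    fin_cases i
    · simp
    · simpa using hpq
    · simpa using hr1.symm
  · simp only [Fin.forall_fin_two]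
    simp only [Matrix.cons_val_zero, Matrix.cons_val_one, Matrix.cons_val, h0]
    refine ⟨⟨⟨?_, ?_⟩, ?_, ?_⟩, ⟨?_, ?_⟩, ?_, ?_⟩ <;> field_simp <;> rw [he] <;> ring

/-- Gates with singular number one. -/
lemma IsSortedModel.hasSchmidtForm_one (h : IsSortedModel U 1 a b) (hr : schmidtRank U = 2) :
    (∃ c α : ℝ, 0 < c ∧ c ≠ 1 ∧
      α ∈ Set.Ioo 0 Real.pi ∪ Set.Ioo Real.pi (2 * Real.pi) ∧ c * Real.cos α ≠ 1 ∧
      HasSchmidtForm U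
        ![qdiag 1 0, qdiag (phase α - c) (phase (-α) - c),
          qdiag 1 (((c ^ 2 - 1) / (1 + c ^ 2 - 2 * c * Real.cos α) : ℝ) : ℂ)]
        ![qdiag c 1, 1, 1]) ∨
    (∃ c α γ θ : ℝ, 0 < c ∧ c ≠ 1 ∧
      α ∈ Set.Ico 0 (2 * Real.pi) ∧ γ ∈ Set.Ico 0 (2 * Real.pi) ∧
      c * Real.cos ((α + γ) / 2) - Real.cos ((α - γ) / 2) ≠ 0 ∧
      θ = 2 * Real.arctan ((c * Real.sin ((α + γ) / 2) - Real.sin ((α - γ) / 2)) /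
        (c * Real.cos ((α + γ) / 2) - Real.cos ((α - γ) / 2))) ∧
      α ≠ γ ∧ α ≠ (Real.pi + θ) / 2 ∧ α ≠ (3 * Real.pi + θ) / 2 ∧
      HasSchmidtForm U
        ![qdiag 1 0, qdiag (phase α - c) (-phase (θ - α) - c),
          qdiag 1 ((phase γ - c) / (phase α - c))]
        ![qdiag c 1, 1, 1]) := by
  obtain ⟨c, p, q, r, hc, hp0, hq0, hr0, hpq, hr1, hm⟩ := h.exists_model_one
  have hform : HasSchmidtForm U ![qdiag 1 0, qdiag p q, qdiag 1 r] ![qdiag c 1, 1, 1] := by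
    refine hm.hasSchmidtForm hr _ _ ?_ ?_ fun _ _ _ => rfl
    · intro i
      fin_cases i <;> rfl
    · intro i
      fin_cases i
      · rfl
      · exact one_eq_diagonal_one
      · exact one_eq_diagonal_one
  obtain ⟨hc1, ⟨α, hα, hcos, rfl, rfl, rfl⟩ |
      ⟨α, γ, θ, hα, hγ, hre, hθ, hαγ, hα1, hα2, rfl, rfl, rfl⟩⟩ :=
    exists_phases_of_circle hc (by simpa using hm.norm_eq_one 0 0 0)
      (by simpa using hm.norm_eq_one 0 1 0) (by simpa using hm.norm_eq_one 0 0 1)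
      (by simpa using hm.norm_eq_one 0 1 1) hp0 hq0 hr0 hpq hr1
  · exact Or.inl ⟨c, α, hc, hc1, hα, hcos, hform⟩
  · exact Or.inr ⟨c, α, γ, θ, hc, hc1, hα, hγ, hre, hθ, hαγ, hα1, hα2, hform⟩

/-- Gates with singular number zero, up to the relations between the parameters. -/
lemma IsDiagonalModel.exists_model_zero (h : IsDiagonalModel U a b) (ha : ∀ i x, a i x ≠ 0)
    (hb : ∀ i x, b i x ≠ 0) :
    ∃ a' b' : ℂ, ∃ c d c' d' : ℂ, a' ≠ 0 ∧ b' ≠ 0 ∧ a' ≠ 1 ∧ b' ≠ 1 ∧ c ≠ 0 ∧ d ≠ 0 ∧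
      b' * c + (1 - b') * c' = 1 ∧ b' * d + (1 - b') * d' = 1 ∧
      IsDiagonalModel U ![![a', b'], ![1, c], ![1, d]]
        ![![1 - a', 1 - b'], ![1, c'], ![1, d']] := by
  obtain ⟨F, hF⟩ : ∃ F : Fin 2 → Fin 2 → Fin 2 → ℂ, ∀ x y z,
      F x y z = a 0 x * a 1 y * a 2 z + b 0 x * b 1 y * b 2 z := ⟨_, fun _ _ _ => rfl⟩
  have hn x y z : ‖F x y z‖ = 1 := by rw [hF]; exact h.norm_eq_one x y z
  have hF0 x y z : F x y z ≠ 0 := fun h' => by simpa [h'] using hn x y z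
  have h100 := hF0 1 0 0
  have h110 := hF0 1 1 0
  have h101 := hF0 1 0 1
  have ha1 x : 1 - a 0 x * a 1 0 * a 2 0 / F x 0 0 = b 0 x * b 1 0 * b 2 0 / F x 0 0 := by
    have := hF0 x 0 0
    field_simp
    rw [hF]; ring
  have hne1 x : a 0 x * a 1 0 * a 2 0 / F x 0 0 ≠ 1 := by
    intro h'
    have h1 := ha1 x
    rw [h', sub_self, eq_comm] at h1
    exact div_ne_zero (mul_ne_zero (mul_ne_zero (hb _ _) (hb _ _)) (hb _ _)) (hF0 _ _ _) h1
  have hne0 x : a 0 x * a 1 0 * a 2 0 / F x 0 0 ≠ 0 :=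
    div_ne_zero (mul_ne_zero (mul_ne_zero (ha _ _) (ha _ _)) (ha _ _)) (hF0 _ _ _)
  have ha10 := ha 1 0
  have ha20 := ha 2 0
  have ha11 := ha 1 1
  have ha21 := ha 2 1
  have hb10 := hb 1 0
  have hb20 := hb 2 0
  have h000 := hF0 0 0 0
  have hd0 := h.det_ne 0
  have hd1 := h.det_ne 1
  have hd2 := h.det_ne 2
  refine ⟨a 0 0 * a 1 0 * a 2 0 / F 0 0 0, a 0 1 * a 1 0 * a 2 0 / F 1 0 0,
    F 1 0 0 / F 1 1 0 * (a 1 1 / a 1 0), F 1 0 0 / F 1 0 1 * (a 2 1 / a 2 0),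
    F 1 0 0 / F 1 1 0 * (b 1 1 / b 1 0), F 1 0 0 / F 1 0 1 * (b 2 1 / b 2 0),
    hne0 0, hne0 1, hne1 0, hne1 1, by positivity, by positivity, ?_, ?_, ?_⟩
  · rw [ha1]
    field_simp
    rw [hF]
    ring
  · rw [ha1]
    field_simp
    rw [hF]
  · rw [ha1, ha1]
    refine h.rephase (u := ![fun x => (F x 0 0)⁻¹, ![1, F 1 0 0 / F 1 1 0],
      ![1, F 1 0 0 / F 1 0 1]]) ?_ ?_ ?_
    · intro i x
      fin_cases i
      · show ‖(F x 0 0)⁻¹‖ = 1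
        rw [norm_inv, hn, inv_one]
      · fin_cases x
        · simp
        · show ‖F 1 0 0 / F 1 1 0‖ = 1
          rw [norm_div, hn, hn, div_one]
      · fin_cases x
        · simp
        · show ‖F 1 0 0 / F 1 0 1‖ = 1
          rw [norm_div, hn, hn, div_one]
    · intro i
      fin_cases i
      · show a 0 0 * a 1 0 * a 2 0 / F 0 0 0 * (b 0 1 * b 1 0 * b 2 0 / F 1 0 0) ≠
          a 0 1 * a 1 0 * a 2 0 / F 1 0 0 * (b 0 0 * b 1 0 * b 2 0 / F 0 0 0)
        intro h'
        field_simp at h'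
        exact hd0 h'
      · show 1 * (F 1 0 0 / F 1 1 0 * (b 1 1 / b 1 0)) ≠ F 1 0 0 / F 1 1 0 * (a 1 1 / a 1 0) * 1
        intro h'
        field_simp at h'
        exact hd1 (by linear_combination h')
      · show 1 * (F 1 0 0 / F 1 0 1 * (b 2 1 / b 2 0)) ≠ F 1 0 0 / F 1 0 1 * (a 2 1 / a 2 0) * 1
        intro h'
        field_simp at h'
        exact hd2 (by linear_combination h')
    · simp only [Fin.forall_fin_two]
      simp only [Matrix.cons_val_zero, Matrix.cons_val_one, Matrix.cons_val]
      refine ⟨⟨⟨?_, ?_⟩, ?_, ?_⟩, ⟨?_, ?_⟩, ?_, ?_⟩ <;> field_simp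

/-- Gates with singular number zero. -/
lemma IsDiagonalModel.hasSchmidtForm_zero (h : IsDiagonalModel U a b) (ha : ∀ i x, a i x ≠ 0)
    (hb : ∀ i x, b i x ≠ 0) (hr : schmidtRank U = 2) :
    ∃ a b c d : ℂ, a ≠ 0 ∧ a ≠ 1 ∧ b ≠ 0 ∧ b ≠ 1 ∧ c ≠ 0 ∧ c ≠ 1 ∧ d ≠ 0 ∧ d ≠ 1 ∧ a ≠ b ∧
      ‖(1 - a) * (1 - d) + d * (1 - b)‖ = ‖1 - b‖ ∧
      ‖(1 - a) * (1 - c) + c * (1 - b)‖ = ‖1 - b‖ ∧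
      ‖(1 - a) * (1 - b * c) * (1 - b * d) + a * c * d * (1 - b) ^ 2‖ = ‖1 - b‖ ^ 2 ∧
      ‖(1 - b * c) * (1 - b * d) + b * c * d * (1 - b)‖ = ‖1 - b‖ ∧
      HasSchmidtForm U
        ![qdiag a b, qdiag 1 c, qdiag 1 d]
        ![qdiag (1 - a) (1 - b), qdiag 1 ((1 - b * c) / (1 - b)),
          qdiag 1 ((1 - b * d) / (1 - b))] := by
  obtain ⟨a, b, c, d, c', d', ha0, hb0, ha1, hb1, hc0, hd0, hc', hd', hm⟩ :=
    h.exists_model_zero ha hb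
  have hb1' : 1 - b ≠ 0 := sub_ne_zero.2 hb1.symm
  obtain rfl : c' = (1 - b * c) / (1 - b) := by
    field_simp
    linear_combination hc'
  obtain rfl : d' = (1 - b * d) / (1 - b) := by
    field_simp
    linear_combination hd'
  refine ⟨a, b, c, d, ha0, ha1, hb0, hb1, hc0, ?_, hd0, ?_, ?_, ?_, ?_, ?_, ?_,
    hm.hasSchmidtForm hr _ _ ?_ ?_ fun _ _ _ => rfl⟩
  · rintro rfl
    apply hm.det_ne 1
    simp [hb1']
  · rintro rfl
    apply hm.det_ne 2
    simp [hb1']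
  · rintro rfl
    apply hm.det_ne 0
    simp
  · have h1 := hm.norm_eq_one 0 0 1
    simp only [Matrix.cons_val_zero, Matrix.cons_val_one, Matrix.cons_val] at h1
    rw [← mul_one ‖1 - b‖, ← h1, ← norm_mul]
    congr 1
    field_simp
    ring
  · have h1 := hm.norm_eq_one 0 1 0
    simp only [Matrix.cons_val_zero, Matrix.cons_val_one, Matrix.cons_val] at h1
    rw [← mul_one ‖1 - b‖, ← h1, ← norm_mul]
    congr 1
    field_simp
    ring
  · have h1 := hm.norm_eq_one 0 1 1
    simp only [Matrix.cons_val_zero, Matrix.cons_val_one, Matrix.cons_val] at h1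
    rw [← mul_one (‖1 - b‖ ^ 2), ← h1, ← norm_pow, ← norm_mul]
    congr 1
    field_simp
    ring
  · have h1 := hm.norm_eq_one 1 1 1
    simp only [Matrix.cons_val_zero, Matrix.cons_val_one, Matrix.cons_val] at h1
    rw [← mul_one ‖1 - b‖, ← h1, ← norm_mul]
    congr 1
    field_simp
    ring
  · intro i
    fin_cases i <;> rfl
  · intro i
    fin_cases i <;> rfl

/-- The diagonal model of a Schmidt decomposition of a genuine gate of Schmidt rank two. -/
lemma IsGenuineUnitary.exists_isDiagonalModel (hU : IsGenuineUnitary U) (hr : schmidtRank U = 2)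
    {k : ℕ} (hk : HasSingularNumber U k) :
    ∃ a b, IsDiagonalModel U a b ∧ singularCount a + singularCount b = k := by
  obtain ⟨r, T, ⟨hT, hr'⟩, rfl⟩ := hk
  rw [hr] at hr'
  subst hr'
  obtain ⟨D, hUD, hnorm, hdet, hsing⟩ := hU.exists_diagonal_decomposition (by norm_num) hT
  refine ⟨D 0, D 1, ⟨?_, fun x y z => ?_, hdet⟩, (numSingular_eq_add hsing).symm⟩
  · simpa only [Fin.sum_univ_two] using hUD.permLUEquivalent
  · simpa [Fin.sum_univ_two, Fin.prod_univ_three] using hnorm ![x, y, z]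

lemma exists_hasSingularNumber (hr : schmidtRank U = 2) : ∃ k, HasSingularNumber U k := by
  have hne : {r : ℕ | ∃ T : Fin r → Fin 3 → LocalOp 2, IsSumOfProducts U T}.Nonempty := by
    apply Nat.nonempty_of_pos_sInf
    change 0 < schmidtRank U
    omega
  obtain ⟨T, hT⟩ := Nat.sInf_mem hne
  exact ⟨_, _, T, ⟨hT, rfl⟩, rfl⟩

end Classification

end MultiOp

theorem theorem2 (U : MultiOp 3 2) (hU : MultiOp.IsGenuineUnitary U)
    (hr : MultiOp.schmidtRank U = 2) :
    (∃ k : ℕ, U ∈ MultiOp.gateClass 3 2 k) ∧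
    ∀ k : ℕ, U ∈ MultiOp.gateClass 3 2 k →
      k ≤ 3 ∧
      (k = 3 →
        ∃ φ : ℝ, φ ∈ Set.Ioo 0 (2 * Real.pi) ∧
          MultiOp.HasSchmidtForm U
            ![1, 1, 1]
            ![(phase φ - 1) • qdiag 1 0, qdiag 1 0, qdiag 1 0]) ∧
      (k = 2 →
        (∃ θ φ : ℝ, θ ∈ Set.Ioo 0 (2 * Real.pi) ∧ φ ∈ Set.Ioo 0 (2 * Real.pi) ∧
          MultiOp.HasSchmidtForm U
            ![1, 1, 1]
            ![qdiag 0 1, qdiag 0 1, qdiag (phase θ - 1) (phase φ - 1)]) ∨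
        (∃ γ δ : ℝ, γ ∈ Set.Ico 0 (2 * Real.pi) ∧ δ ∈ Set.Ico 0 (2 * Real.pi) ∧
          MultiOp.HasSchmidtForm U
            ![qdiag 1 0, 1, 1]
            ![qdiag 0 1, qdiag 1 (phase γ), qdiag 1 (phase δ)])) ∧
      (k = 1 →
        (∃ c α : ℝ, 0 < c ∧ c ≠ 1 ∧
          α ∈ Set.Ioo 0 Real.pi ∪ Set.Ioo Real.pi (2 * Real.pi) ∧ c * Real.cos α ≠ 1 ∧
          MultiOp.HasSchmidtForm U
            ![qdiag 1 0, qdiag (phase α - c) (phase (-α) - c),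
              qdiag 1 (((c ^ 2 - 1) / (1 + c ^ 2 - 2 * c * Real.cos α) : ℝ) : ℂ)]
            ![qdiag c 1, 1, 1]) ∨
        (∃ c α γ θ : ℝ, 0 < c ∧ c ≠ 1 ∧
          α ∈ Set.Ico 0 (2 * Real.pi) ∧ γ ∈ Set.Ico 0 (2 * Real.pi) ∧
          c * Real.cos ((α + γ) / 2) - Real.cos ((α - γ) / 2) ≠ 0 ∧
          θ = 2 * Real.arctan ((c * Real.sin ((α + γ) / 2) - Real.sin ((α - γ) / 2)) /
            (c * Real.cos ((α + γ) / 2) - Real.cos ((α - γ) / 2))) ∧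
          α ≠ γ ∧ α ≠ (Real.pi + θ) / 2 ∧ α ≠ (3 * Real.pi + θ) / 2 ∧
          MultiOp.HasSchmidtForm U
            ![qdiag 1 0, qdiag (phase α - c) (-phase (θ - α) - c),
              qdiag 1 ((phase γ - c) / (phase α - c))]
            ![qdiag c 1, 1, 1])) ∧
      (k = 0 →
        ∃ a b c d : ℂ, a ≠ 0 ∧ a ≠ 1 ∧ b ≠ 0 ∧ b ≠ 1 ∧ c ≠ 0 ∧ c ≠ 1 ∧ d ≠ 0 ∧ d ≠ 1 ∧ a ≠ b ∧
          ‖(1 - a) * (1 - d) + d * (1 - b)‖ = ‖1 - b‖ ∧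
          ‖(1 - a) * (1 - c) + c * (1 - b)‖ = ‖1 - b‖ ∧
          ‖(1 - a) * (1 - b * c) * (1 - b * d) + a * c * d * (1 - b) ^ 2‖ = ‖1 - b‖ ^ 2 ∧
          ‖(1 - b * c) * (1 - b * d) + b * c * d * (1 - b)‖ = ‖1 - b‖ ∧
          MultiOp.HasSchmidtForm U
            ![qdiag a b, qdiag 1 c, qdiag 1 d]
            ![qdiag (1 - a) (1 - b), qdiag 1 ((1 - b * c) / (1 - b)),
              qdiag 1 ((1 - b * d) / (1 - b))]) := by
  have hsorted {k : ℕ} {a b : Fin 3 → Fin 2 → ℂ} (h : MultiOp.IsSortedModel U k a b) (hk : k = 0) :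
      ∀ i x, a i x ≠ 0 := by
    intro i x
    fin_cases x
    · exact h.ne_zero_left i
    · exact h.ne_zero_right i (by omega)
  refine ⟨?_, ?_⟩
  · obtain ⟨k, hk⟩ := MultiOp.exists_hasSingularNumber hr
    exact ⟨k, hU, hr, hk⟩
  rintro k ⟨-, -, hk⟩
  obtain ⟨a, b, hab, hcount⟩ := hU.exists_isDiagonalModel hr hk
  have hform := hab.exists_normalForm
  rw [hcount] at hform
  rcases hform with ⟨rfl, a, b, hm, ha, hb, hne⟩ | ⟨hk3, a, b, hm⟩
  · exact ⟨by norm_num, by norm_num,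
      fun _ => Or.inr (hm.hasSchmidtForm_controlled hr ha hb hne), by norm_num, by norm_num⟩
  · refine ⟨hk3, ?_, ?_, ?_, ?_⟩
    · rintro rfl
      exact hm.hasSchmidtForm_three hr
    · rintro rfl
      exact Or.inl (hm.hasSchmidtForm_two hr)
    · rintro rfl
      exact hm.hasSchmidtForm_one hr
    · intro h0
      exact hm.isDiagonalModel.hasSchmidtForm_zero (hsorted hm h0) hm.ne_zero hr
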